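/- For $\lambda\in\mathbb C$, $r>0$ let $D(\lambda,r)=\{z:|z-\lambda|<r\}$ and $\mathbb D=D(0,1)$. A *string of beads set* is a set $K=\overline{\mathbb D}\setminus\bigcup_{n\ge1}D(\lambda_n,r_n)$, where $\lambda_n\in\mathbb R$, $r_n>0$, $D(\lambda_n,r_n)\subset\mathbb D$, the closed disks $\overline{D(\lambda_n,r_n)}$ are pairwise disjoint, and $K\cap\mathbb R$ has empty interior in $\mathbb R$ and positive length. Put $\Omega=\operatorname{int}K$, $\Omega_U=\{z\in\Omega:\operatorname{Im}z>0\}$, $\Omega_L=\Omega\setminus\Omega_U$. Let $\partial_iK$ be the inner boundary of $K$, i.e. $\partial K$ minus the union of the boundaries of the components of $\mathbb C\setminus K$ (so $\partial_iK\subset\mathbb R$), and let $l$ be length on $\mathbb R$ restricted to $\partial_iK$. For a finite positive Borel measure $\mu$ on $K$, let $R^2(K,\mu)$ be the closure in $L^2(\mu)$ of $\mathrm{Rat}(K)$, the rational functions with poles off $K$. A point $z$ is a *bounded point evaluation* for $R^2(K,\mu)$ if $|q(z)|\le C\|q\|_{L^2(\mu)}$ for some $C$ and all $q\in\mathrm{Rat}(K)$,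 and an *analytic bounded point evaluation* if it is interior to the set of bounded point evaluations and one constant $C$ serves a whole disk about it. For $f\in R^2(K,\mu)$ and a bounded point evaluation $z$, let $\rho(f)(z)$ be the value at $f$ of the continuous extension of $q\mapsto q(z)$ to $R^2(K,\mu)$. Let $S_\mu$ be multiplication by $z$ on $R^2(K,\mu)$; $S_\mu$ is *irreducible* if $R^2(K,\mu)$ contains no non-trivial characteristic function (if $\chi_A\in R^2(K,\mu)$ for a Borel set $A$, then $\mu(A)=0$ or $\mu(\mathbb C\setminus A)=0$). **Statement.** Let $K$ be a string of beads set with $\pm\frac i2\in\Omega$. Let $\omega_a$ and $\omega_b$ be the harmonic measures of $\Omega_U$ and $\Omega_L$ evaluated at $a=\frac i2$ and $b=-\frac i2$, and let $\omega=\omega_a+\omega_b$. Then every point of $\Omega$ is an analytic bounded point evaluation for $R^2(K,\omega)$, and for every $f\in R^2(K,\omega)$ the following holds for $l$-almost every $\lambda\in\partial_iK$ and every $0<\alpha\le1$: for some $n\ge1$ the cones $$U_n(\lambda,\alpha)=\{z:|\operatorname{Re}(z-\lambda)|<\alpha\operatorname{Im}(z-\lambda)\}\cap D(\lambda,\tfrac1n),\qquad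 L_n(\lambda,\alpha)=\{z:|\operatorname{Re}(z-\lambda)|<-\alpha\operatorname{Im}(z-\lambda)\}\cap D(\lambda,\tfrac1n)$$ are contained in $\Omega$, the non-tangential limits of $\rho(f)$ from the top and from the bottom, $$f_+(\lambda)=\lim_{U_n(\lambda,\alpha)\ni z\to\lambda}\rho(f)(z),\qquad f_-(\lambda)=\lim_{L_n(\lambda,\alpha)\ni z\to\lambda}\rho(f)(z),$$ exist, and $f_+(\lambda)=f_-(\lambda)=f(\lambda)$. Moreover, $S_\omega$ is irreducible. -/

import Mathlib

open MeasureTheory Filter Topology Metric Set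
open scoped ENNReal

noncomputable section

namespace MeanRational

/-! ### String of beads sets -/

/-- `K` is a string of beads set: the closed unit disk with a sequence of open disks removed, the
disks being centred on the real line, contained in the open unit disk and with pairwise disjoint
closures, such that `K ∩ ℝ` has empty interior in `ℝ` and positive length. -/
def IsStringOfBeads (K : Set ℂ) : Prop :=
  ∃ (c r : ℕ → ℝ),
    (∀ n, 0 < r n) ∧
    (∀ n, ball (c n : ℂ) (r n) ⊆ ball 0 1) ∧
    (Pairwise fun i j => Disjoint (closedBall (c i : ℂ) (r i)) (closedBall (c j : ℂ) (r j))) ∧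
    K = closedBall 0 1 \ ⋃ n, ball (c n : ℂ) (r n) ∧
    interior {x : ℝ | (x : ℂ) ∈ K} = ∅ ∧
    0 < volume {x : ℝ | (x : ℂ) ∈ K}

/-- `Ω_U`, the part of `Ω = int K` in the open upper half plane. -/
def upperPart (K : Set ℂ) : Set ℂ := {z ∈ interior K | 0 < z.im}

/-- `Ω_L = Ω \ Ω_U`, where `Ω = int K`. -/
def lowerPart (K : Set ℂ) : Set ℂ := interior K \ upperPart K

/-- The exterior boundary `∂ₑK`: the union of the boundaries of the components of `ℂ \ K`. -/
def outerBoundary (K : Set ℂ) : Set ℂ := ⋃ z ∈ Kᶜ, frontier (connectedComponentIn Kᶜ z)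

/-- The inner boundary `∂ᵢK = ∂K \ ∂ₑK`. -/
def innerBoundary (K : Set ℂ) : Set ℂ := frontier K \ outerBoundary K

/-! ### Harmonic measure -/

/-- `μ` is the harmonic measure of the bounded domain `G` evaluated at `a`: the Borel probability
measure on `∂G` which represents evaluation at `a` for the functions that are continuous on the
closure of `G` and harmonic in `G`. It is unique when the Dirichlet problem is solvable on `G` for
all continuous boundary data, for example when `G` is a Jordan domain. -/
structure IsHarmonicMeasure (G : Set ℂ) (a : ℂ) (μ : Measure ℂ) : Prop where
  isProbabilityMeasure : IsProbabilityMeasure μ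
  measure_compl_frontier : μ (frontier G)ᶜ = 0
  integral_eq : ∀ u : ℂ → ℝ, InnerProductSpace.HarmonicContOnCl u G → ∫ z, u z ∂μ = u a

open Classical in
/-- The harmonic measure of `G` evaluated at `a` (it exists for bounded open `G` and `a ∈ G`, see
`isHarmonicMeasure_harmonicMeasure`; otherwise the value may be the junk value `0`). -/
def harmonicMeasure (G : Set ℂ) (a : ℂ) : Measure ℂ :=
  if h : ∃ μ, IsHarmonicMeasure G a μ then h.choose else 0

/-- The minimum principle. -/
theorem nonneg_of_nonneg_frontier {G : Set ℂ} (hG : IsOpen G) (hb : Bornology.IsBounded G)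
    {u : ℂ → ℝ} (hu : InnerProductSpace.HarmonicContOnCl u G) (h0 : ∀ z ∈ frontier G, 0 ≤ u z)
    {a : ℂ} (ha : a ∈ G) : 0 ≤ u a := by
  by_contra! hneg
  have hcl : IsCompact (closure G) := hb.isCompact_closure
  obtain ⟨z0, hz0, hmin⟩ := hcl.exists_isMinOn ⟨a, subset_closure ha⟩ hu.continuousOn
  set M : Set ℂ := {z ∈ closure G | u z = u z0} with hM
  have hMc : IsCompact M := by
    have : IsClosed M := by
      have := hu.continuousOn.preimage_isClosed_of_isClosed isClosed_closure
        (isClosed_singleton (x := u z0))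
      exact this
    exact hcl.of_isClosed_subset this (fun z hz => hz.1)
  obtain ⟨w, hw, hmax⟩ := hMc.exists_isMaxOn ⟨z0, hz0, rfl⟩ Complex.continuous_re.continuousOn
  have hle : ∀ z ∈ closure G, u w ≤ u z := fun z hz => by rw [hw.2]; exact hmin hz
  have hwneg : u w < 0 := lt_of_le_of_lt (hle a (subset_closure ha)) hneg
  have hwG : w ∈ G := by
    by_contra hwG
    have : w ∈ frontier G := by rw [hG.frontier_eq]; exact ⟨hw.1, hwG⟩
    exact absurd (h0 w this) (not_le.2 hwneg)
  obtain ⟨R, hR, hball⟩ := Metric.isOpen_iff.1 hG w hwG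
  obtain ⟨F, hF, hFu⟩ := InnerProductSpace.HarmonicOnNhd.exists_analyticOnNhd_ball_re_eq
    (hu.harmonicOnNhd.mono hball)
  have hnhds : ball w R ∈ 𝓝 w := ball_mem_nhds w hR
  have hnorm : ∀ z ∈ ball w R, ‖Complex.exp (-F z)‖ = Real.exp (-u z) := by
    intro z hz
    rw [Complex.norm_exp, Complex.neg_re]
    have := hFu hz
    simp only at this
    rw [this]
  have hloc : ∀ᶠ z in 𝓝 w, ‖Complex.exp (-F z)‖ = ‖Complex.exp (-F w)‖ := by
    apply Complex.norm_eventually_eq_of_isLocalMax (f := fun z => Complex.exp (-F z))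
    · filter_upwards [hnhds] with z hz
      exact ((hF z hz).differentiableAt.neg).cexp
    · filter_upwards [hnhds] with z hz
      simp only [Function.comp]
      rw [hnorm z hz, hnorm w (mem_ball_self hR)]
      exact Real.exp_le_exp.2 (neg_le_neg (hle z (subset_closure (hball hz))))
  obtain ⟨δ, hδ, hδ'⟩ := Metric.eventually_nhds_iff_ball.1 hloc
  set ε : ℝ := min δ R / 2 with hε
  have hmpos : 0 < min δ R := lt_min hδ hR
  have hεpos : 0 < ε := by positivity
  have hlt : ε < min δ R := half_lt_self hmpos
  have hd : dist (w + (ε : ℂ)) w = ε := by simp [dist_eq_norm, abs_of_pos hεpos]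
  have h1 : w + (ε : ℂ) ∈ ball w δ := by
    rw [mem_ball, hd]; exact hlt.trans_le (min_le_left _ _)
  have h2 : w + (ε : ℂ) ∈ ball w R := by
    rw [mem_ball, hd]; exact hlt.trans_le (min_le_right _ _)
  have h3 := hδ' _ h1
  rw [hnorm _ h2, hnorm w (mem_ball_self hR), Real.exp_eq_exp, neg_inj] at h3
  have h4 : w + (ε : ℂ) ∈ M := ⟨subset_closure (hball h2), by rw [h3, hw.2]⟩
  have h5 := hmax h4
  simp at h5
  linarith

/-- Harmonic measure exists on every bounded open set. -/
theorem exists_isHarmonicMeasure {G : Set ℂ} (hG : IsOpen G) (hb : Bornology.IsBounded G) {a : ℂ}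
    (ha : a ∈ G) : ∃ μ, IsHarmonicMeasure G a μ := by
  have hK : IsCompact (frontier G) :=
    hb.isCompact_closure.of_isClosed_subset isClosed_frontier frontier_subset_closure
  have : CompactSpace (frontier G) := isCompact_iff_compactSpace.1 hK
  let g : Submodule ℝ (C(frontier G, ℝ) × ℝ) :=
    { carrier := {x | ∃ u : ℂ → ℝ, InnerProductSpace.HarmonicContOnCl u G ∧
        (∀ z : frontier G, x.1 z = u z) ∧ x.2 = u a}
      add_mem' := by
        rintro x y ⟨u, hu, h1, h2⟩ ⟨v, hv, h3, h4⟩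
        exact ⟨u + v, hu.add hv, fun z => by simp [h1, h3], by simp [h2, h4]⟩
      zero_mem' := ⟨fun _ => 0, InnerProductSpace.harmonicContOnCl_const, by simp, by simp⟩
      smul_mem' := by
        rintro c x ⟨u, hu, h1, h2⟩
        exact ⟨c • u, hu.const_smul c, fun z => by simp [h1], by simp [h2]⟩ }
  have hpos : ∀ x ∈ g, (∀ z, 0 ≤ x.1 z) → 0 ≤ x.2 := by
    rintro x ⟨u, hu, h1, h2⟩ hx
    rw [h2]
    exact nonneg_of_nonneg_frontier hG hb hu (fun z hz => by rw [← h1 ⟨z, hz⟩]; exact hx _) ha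
  have hg : ∀ x ∈ g, x.1 = 0 → x.2 = 0 := by
    intro x hx h
    refine le_antisymm ?_ (hpos x hx (by simp [h]))
    have := hpos (-x) (g.neg_mem hx) (by simp [h])
    simpa using this
  have hgraph := g.toLinearPMap_graph_eq hg
  let s : PointedCone ℝ C(frontier G, ℝ) := ConvexCone.toPointedCone
    { carrier := {f | ∀ z, 0 ≤ f z}
      smul_mem' := by
        intro c hc f hf z
        exact mul_nonneg hc.le (hf z)
      add_mem' := by
        intro f hf f' hf' z
        exact add_nonneg (hf z) (hf' z) } (by
          intro z
          simp)
  have hs : ∀ f, f ∈ s ↔ ∀ z, 0 ≤ f z := fun f => Iff.rfl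
  have hmem : ∀ u : ℂ → ℝ, ∀ hu : InnerProductSpace.HarmonicContOnCl u G, ∀ f : C(frontier G, ℝ),
      (∀ z : frontier G, f z = u z) → (f, u a) ∈ g := fun u hu f hf => ⟨u, hu, hf, rfl⟩
  obtain ⟨Λ, hΛ, hΛpos⟩ := riesz_extension s g.toLinearPMap
    (fun x hx => hpos _ (g.mem_graph_toLinearPMap hg x) hx)
    (by
      intro f
      have h := hmem (fun _ => ‖f‖) InnerProductSpace.harmonicContOnCl_const
        (ContinuousMap.const _ ‖f‖) (fun _ => rfl)
      refine ⟨⟨ContinuousMap.const _ ‖f‖, Submodule.mem_map.2 ⟨_, h, rfl⟩⟩, ?_⟩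
      rw [hs]
      intro z
      have h1 := f.norm_coe_le_norm z
      have h2 := neg_abs_le (f z)
      rw [Real.norm_eq_abs] at h1
      simp only [ContinuousMap.add_apply, ContinuousMap.const_apply]
      linarith)
  have hΛg : ∀ x ∈ g, Λ x.1 = x.2 := by
    intro x hx
    have hx' := hx
    rw [← hgraph] at hx'
    obtain ⟨y, hy1, hy2⟩ := (LinearPMap.mem_graph_iff _).1 hx'
    rw [← hy1, hΛ y, hy2]
  let Λc : CompactlySupportedContinuousMap (frontier G) ℝ →ₚ[ℝ] ℝ :=
    PositiveLinearMap.mk₀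
      { toFun := fun f => Λ f.toContinuousMap
        map_add' := fun f f' => by rw [← map_add]; rfl
        map_smul' := fun c f => by rw [RingHom.id_apply, ← map_smul]; rfl }
      (by
        intro f hf
        exact hΛpos _ (fun z => hf z))
  set ν : Measure (frontier G) := RealRMK.rieszMeasure Λc with hν
  have hint : ∀ f : C(frontier G, ℝ), ∫ z, f z ∂ν = Λ f := by
    intro f
    exact RealRMK.integral_rieszMeasure Λc (CompactlySupportedContinuousMap.continuousMapEquiv f)
  have : IsFiniteMeasure ν := ⟨isCompact_univ.measure_lt_top⟩
  have hemb : MeasurableEmbedding (Subtype.val : frontier G → ℂ) :=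
    MeasurableEmbedding.subtype_coe isClosed_frontier.measurableSet
  have hint' : ∀ u : ℂ → ℝ, InnerProductSpace.HarmonicContOnCl u G →
      ∫ z, u z ∂(ν.map Subtype.val) = u a := by
    intro u hu
    rw [hemb.integral_map]
    have hc : Continuous fun z : frontier G => u z :=
      (hu.continuousOn.mono frontier_subset_closure).domRestrict
    have := hint ⟨_, hc⟩
    simp only [ContinuousMap.coe_mk] at this
    rw [this]
    exact hΛg _ (hmem u hu ⟨_, hc⟩ (fun _ => rfl))
  refine ⟨ν.map Subtype.val, ?_, ?_, hint'⟩
  · have : IsFiniteMeasure (ν.map (Subtype.val : frontier G → ℂ)) :=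
      Measure.isFiniteMeasure_map ν _
    have h1 := hint' (fun _ => 1) InnerProductSpace.harmonicContOnCl_const
    rw [integral_const, smul_eq_mul, mul_one] at h1
    refine ⟨?_⟩
    rw [← ENNReal.toReal_eq_one_iff]
    exact h1
  · rw [hemb.map_apply]
    have : (Subtype.val : frontier G → ℂ) ⁻¹' (frontier G)ᶜ = ∅ := by
      ext z; simp
    rw [this, measure_empty]

/-- The defining property of harmonic measure. -/
theorem isHarmonicMeasure_harmonicMeasure {G : Set ℂ} (hG : IsOpen G)
    (hb : Bornology.IsBounded G) {a : ℂ} (ha : a ∈ G) :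
    IsHarmonicMeasure G a (harmonicMeasure G a) := by
  have h := exists_isHarmonicMeasure hG hb ha
  rw [harmonicMeasure, dif_pos h]
  exact h.choose_spec

/-! ### The spaces `R^t(K, μ)` -/

/-- `Rat(K)`: the rational functions with poles off `K` (as functions on `ℂ`; their values at the
poles play no role). -/
def ratFunctions (K : Set ℂ) : Set (ℂ → ℂ) :=
  {q | ∃ p d : Polynomial ℂ, (∀ z ∈ K, d.eval z ≠ 0) ∧ q = fun z => p.eval z / d.eval z}

/-- `R^t(K, μ)`: the closure of `Rat(K)` in `L^t(μ)`. -/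
def rationalLp (K : Set ℂ) (t : ℝ≥0∞) [Fact (1 ≤ t)] (μ : Measure ℂ) : Set (Lp ℂ t μ) :=
  closure {f | ∃ q ∈ ratFunctions K, f =ᵐ[μ] q}

/-- The bounded point evaluations for `R^t(K, μ)`. -/
def bpe (K : Set ℂ) (t : ℝ≥0∞) (μ : Measure ℂ) : Set ℂ :=
  {z | z ∈ K ∧ ∃ C : ℝ, ∀ q ∈ ratFunctions K, ‖q z‖ ≤ C * (eLpNorm q t μ).toReal}

/-- The analytic bounded point evaluations for `R^t(K, μ)`. -/
def abpe (K : Set ℂ) (t : ℝ≥0∞) (μ : Measure ℂ) : Set ℂ :=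
  {z₀ | z₀ ∈ interior (bpe K t μ) ∧ ∃ r > 0, ∃ M > 0, ∀ z ∈ ball z₀ r, ∀ q ∈ ratFunctions K,
    ‖q z‖ ≤ M * (eLpNorm q t μ).toReal}

/-- The evaluation map `ρ`: for `f ∈ R^t(K, μ)` and a bounded point evaluation `z`, `ρ(f)(z)` is
the value at `f` of the continuous extension to `R^t(K, μ)` of the functional `q ↦ q(z)` on
`Rat(K)`, that is, the limit of `q(z)` as `q ∈ Rat(K)` tends to `f` in `L^t(μ)`. -/
def evalMap (K : Set ℂ) (t : ℝ≥0∞) (μ : Measure ℂ) (f : ℂ → ℂ) (z : ℂ) : ℂ :=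
  limUnder (comap (fun q : ratFunctions K => eLpNorm (fun w => f w - q.1 w) t μ) (𝓝 0))
    (fun q => q.1 z)

/-- Multiplication by `z` on `R^t(K, μ)` is irreducible: `R^t(K, μ)` contains no non-trivial
characteristic function. -/
def IsIrreducibleMul (K : Set ℂ) (t : ℝ≥0∞) [Fact (1 ≤ t)] (μ : Measure ℂ) : Prop :=
  ∀ A : Set ℂ, MeasurableSet A →
    (∃ f ∈ rationalLp K t μ, f =ᵐ[μ] A.indicator fun _ => (1 : ℂ)) → μ A = 0 ∨ μ Aᶜ = 0

/-! ### Non-tangential limits -/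

/-- The truncated upper cone `U_n(w, α)`. -/
def upperCone (n : ℕ) (w : ℂ) (α : ℝ) : Set ℂ :=
  {z | |(z - w).re| < α * (z - w).im} ∩ ball w (1 / n)

/-- The truncated lower cone `L_n(w, α)`. -/
def lowerCone (n : ℕ) (w : ℂ) (α : ℝ) : Set ℂ :=
  {z | |(z - w).re| < -α * (z - w).im} ∩ ball w (1 / n)

/-- `F`, a function on `Ω`, has limit `l` at `w` through the cone `U_n(w, α)`, which is contained in
`Ω` for some `n ≥ 1`. -/
def HasTopLimit (Ω : Set ℂ) (F : ℂ → ℂ) (w : ℂ) (α : ℝ) (l : ℂ) : Prop :=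
  ∃ n : ℕ, 0 < n ∧ upperCone n w α ⊆ Ω ∧ Tendsto F (𝓝[upperCone n w α] w) (𝓝 l)

/-- `F`, a function on `Ω`, has limit `l` at `w` through the cone `L_n(w, α)`, which is contained in
`Ω` for some `n ≥ 1`. -/
def HasBottomLimit (Ω : Set ℂ) (F : ℂ → ℂ) (w : ℂ) (α : ℝ) (l : ℂ) : Prop :=
  ∃ n : ℕ, 0 < n ∧ lowerCone n w α ⊆ Ω ∧ Tendsto F (𝓝[lowerCone n w α] w) (𝓝 l)

end MeanRational

end

noncomputable section

namespace MeanRational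

/-! ### Geometry of string of beads sets -/

/-! Since `K ∩ ℝ` has no interior, `Ω` misses the real line and splits into an upper and a lower
side, each connected. Everything rests on the fact that both sides see `K ∩ ℝ`: length there is
absolutely continuous with respect to each of the two harmonic measures.

Let `G` be a side, `a` its base point, `μ` its harmonic measure. If `q` is analytic in `G` and
continuous on the closure, then `q(z) W(z) = ∫ q(ζ) (ζ - a) / (ζ - z) dμ`, where `W` is
`cauchyWeight` (`IsHarmonicMeasure.mul_cauchyWeight`). As `W` is analytic and `W(a) = 1`, its zeros
are isolated. Every point has a small circle around it free of zeros, and the maximum principle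
bounds `q` inside by its `L¹(μ)` norm (`IsHarmonicMeasure.exists_norm_le`). Hence points of `Ω` are
analytic bounded point evaluations.

Absolute continuity (`IsBeads.volume_eq_zero`) comes from Thales' theorem. Let `P` be the Poisson
integral, times `π`, of a compact `E ⊆ K ∩ ℝ`. On the unit circle and on the bead circles `P ≤ π/2`,
because `E` lies inside the diameter of the former and outside those of the latter; on the line off
`E`, `P = 0`. If `μ(E) = 0`, analytic functions of modulus `exp (N (2P - π))` are thus at most `1`
`μ`-almost everywhere. The `L¹` bound, uniform in `N`, forces `P ≤ π/2` in all of `G`. Above a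
density point of `E` this fails, so `E` has length zero.

For the boundary values (`IsBeads.ae_tendsto_evalMap`), the Cauchy kernel at the conjugate point,
which lies outside the closure of `G`, can be subtracted, leaving a Poisson-like kernel. Almost
every `x` in `K ∩ ℝ` is the vertex of cones in `Ω`, a Lebesgue point of `f` for `μ`, and a point
where `μ` is comparable to length with negligible mass off the line. There `W` stays away from zero
in the cone and the averages of `f` converge to `f(x)`, from either side.

For irreducibility, evaluation at `a` is multiplicative, so `μ(A)` is idempotent when `χ_A` is
approximable (`measure_eq_zero_or_one`). The two measures cannot disagree about `A`, for otherwise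
`K ∩ ℝ` would be the union of two sets of length zero. -/

/-- The part of `int K` on the side of the real line given by the sign `σ`. -/
def sidePart (K : Set ℂ) (σ : ℝ) : Set ℂ := {z ∈ interior K | 0 < σ * z.im}

/-- `K` is the closed unit disk without the disks with centres `c n` and radii `r n`. -/
structure IsBeads (K : Set ℂ) (c r : ℕ → ℝ) : Prop where
  pos : ∀ n, 0 < r n
  ball_subset : ∀ n, ball (c n : ℂ) (r n) ⊆ ball 0 1
  disjoint : Pairwise fun i j =>
    Disjoint (closedBall (c i : ℂ) (r i)) (closedBall (c j : ℂ) (r j))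
  eq_diff : K = closedBall 0 1 \ ⋃ n, ball (c n : ℂ) (r n)
  interior_real : interior {x : ℝ | (x : ℂ) ∈ K} = ∅

theorem isOpen_sidePart (K : Set ℂ) (σ : ℝ) : IsOpen (sidePart K σ) :=
  isOpen_interior.inter (isOpen_lt continuous_const (continuous_const.mul Complex.continuous_im))

theorem sidePart_subset {K : Set ℂ} {σ : ℝ} : sidePart K σ ⊆ K :=
  fun _ hz => interior_subset hz.1

theorem closure_sidePart_le {K : Set ℂ} {σ : ℝ} {z : ℂ} (hz : z ∈ closure (sidePart K σ)) : 0 ≤ σ * z.im := by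
  have : closure (sidePart K σ) ⊆ {w : ℂ | 0 ≤ σ * w.im} :=
    closure_minimal (fun w hw => hw.2.le)
      (isClosed_le continuous_const (continuous_const.mul Complex.continuous_im))
  exact this hz

theorem upperPart_eq (K : Set ℂ) : upperPart K = sidePart K 1 := by
  simp [upperPart, sidePart]

namespace IsBeads

variable {K : Set ℂ} {c r : ℕ → ℝ}

theorem mem_iff (h : IsBeads K c r) {z : ℂ} :
    z ∈ K ↔ ‖z‖ ≤ 1 ∧ ∀ n, r n ≤ ‖z - c n‖ := by
  rw [h.eq_diff]
  simp [dist_eq_norm]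

theorem isClosed (h : IsBeads K c r) : IsClosed K := by
  rw [h.eq_diff]
  exact isClosed_closedBall.sdiff (isOpen_iUnion fun _ => isOpen_ball)

theorem isBounded (h : IsBeads K c r) : Bornology.IsBounded K := by
  rw [h.eq_diff]
  exact isBounded_closedBall.subset sdiff_subset

theorem isCompact (h : IsBeads K c r) : IsCompact K :=
  Metric.isCompact_of_isClosed_isBounded h.isClosed h.isBounded

theorem closure_sidePart_subset (h : IsBeads K c r) (σ : ℝ) : closure (sidePart K σ) ⊆ K :=
  closure_minimal sidePart_subset h.isClosed

theorem isBounded_sidePart (h : IsBeads K c r) (σ : ℝ) : Bornology.IsBounded (sidePart K σ) :=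
  h.isBounded.subset sidePart_subset

theorem closedBall_subset (h : IsBeads K c r) (n : ℕ) :
    closedBall (c n : ℂ) (r n) ⊆ closedBall 0 1 := by
  rw [← closure_ball _ (h.pos n).ne']
  exact closure_minimal ((h.ball_subset n).trans ball_subset_closedBall) isClosed_closedBall

theorem add_le (h : IsBeads K c r) (n : ℕ) : c n + r n ≤ 1 := by
  have h1 : ((c n + r n : ℝ) : ℂ) ∈ closedBall (0 : ℂ) 1 := by
    apply h.closedBall_subset n
    simp [abs_of_pos (h.pos n)]
  rw [mem_closedBall_zero_iff, Complex.norm_real, Real.norm_eq_abs] at h1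
  exact (abs_le.1 h1).2

theorem le_sub (h : IsBeads K c r) (n : ℕ) : -1 ≤ c n - r n := by
  have h1 : ((c n - r n : ℝ) : ℂ) ∈ closedBall (0 : ℂ) 1 := by
    apply h.closedBall_subset n
    simp [abs_of_pos (h.pos n)]
  rw [mem_closedBall_zero_iff, Complex.norm_real, Real.norm_eq_abs] at h1
  exact (abs_le.1 h1).1

/-- The real diameters of the beads are disjoint intervals in `[-1, 1]`. -/
theorem tsum_ne_top (h : IsBeads K c r) : ∑' n, ENNReal.ofReal (r n) ≠ ∞ := by
  have h1 : ∑' n, volume (Ioo (c n - r n) (c n + r n)) ≤ volume (Icc (-1 : ℝ) 1) := by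
    rw [← measure_iUnion _ (fun n => measurableSet_Ioo)]
    · refine measure_mono (iUnion_subset fun n => ?_)
      intro x hx
      exact ⟨(h.le_sub n).trans hx.1.le, hx.2.le.trans (h.add_le n)⟩
    · intro i j hij
      refine Set.disjoint_left.2 fun x hx hx' => ?_
      refine Set.disjoint_left.1 (h.disjoint hij) (show (x : ℂ) ∈ _ from ?_) ?_
      · rw [mem_closedBall, Complex.dist_of_im_eq (by simp)]
        simp only [Complex.ofReal_re, Real.dist_eq, abs_le]
        exact ⟨by linarith [hx.1], by linarith [hx.2]⟩
      · rw [mem_closedBall, Complex.dist_of_im_eq (by simp)]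
        simp only [Complex.ofReal_re, Real.dist_eq, abs_le]
        exact ⟨by linarith [hx'.1], by linarith [hx'.2]⟩
  refine ne_top_of_le_ne_top (b := volume (Icc (-1 : ℝ) 1)) (by simp) (le_trans ?_ h1)
  refine ENNReal.tsum_le_tsum fun n => ?_
  rw [Real.volume_Ioo]
  exact ENNReal.ofReal_le_ofReal (by linarith [h.pos n])

theorem eventually_lt (h : IsBeads K c r) {ε : ℝ} (hε : 0 < ε) : ∀ᶠ n in atTop, r n < ε := by
  have h1 := ENNReal.tendsto_atTop_zero_of_tsum_ne_top h.tsum_ne_top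
  filter_upwards [(ENNReal.tendsto_nhds_zero.1 h1) (ENNReal.ofReal (ε / 2)) (by simpa using hε)]
    with n hn
  rw [ENNReal.ofReal_le_ofReal_iff (by linarith)] at hn
  linarith

theorem im_ne_zero (h : IsBeads K c r) {z : ℂ} (hz : z ∈ interior K) : z.im ≠ 0 := by
  intro h0
  have h1 : z.re ∈ interior {x : ℝ | (x : ℂ) ∈ K} := by
    rw [mem_interior_iff_mem_nhds] at hz ⊢
    have : (z.re : ℂ) = z := by apply Complex.ext <;> simp [h0]
    exact Complex.continuous_ofReal.continuousAt.preimage_mem_nhds (by rwa [this])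
  rw [h.interior_real] at h1
  exact h1

/-- Infinitely many strict inequalities remain an open condition here: all but finitely many radii
are below `|Im z| / 2`, and those beads, being centred on the line, do not come near `z`. -/
theorem mem_interior_of_im_ne_zero (h : IsBeads K c r) {z : ℂ} (hz : z.im ≠ 0) (h1 : ‖z‖ < 1)
    (h2 : ∀ n, r n < ‖z - c n‖) : z ∈ interior K := by
  obtain ⟨N, hN⟩ := eventually_atTop.1 (h.eventually_lt (half_pos (abs_pos.2 hz)))
  rw [mem_interior_iff_mem_nhds]
  have e1 : ∀ᶠ w : ℂ in 𝓝 z, ‖w‖ < 1 :=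
    (continuous_norm (E := ℂ)).continuousAt.eventually_lt_const h1
  have e2 : ∀ᶠ w : ℂ in 𝓝 z, ∀ n ∈ Finset.range N, r n < ‖w - c n‖ := by
    rw [Filter.eventually_all_finset]
    intro n _
    have : Continuous fun w : ℂ => ‖w - c n‖ := by fun_prop
    exact this.continuousAt.eventually_const_lt (h2 n)
  have e3 : ∀ᶠ w : ℂ in 𝓝 z, |z.im| / 2 < |w.im| := by
    have : ContinuousAt (fun w : ℂ => |w.im|) z := by fun_prop
    exact this.eventually_const_lt (half_lt_self (abs_pos.2 hz))
  filter_upwards [e1, e2, e3] with w w1 w2 w3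
  refine h.mem_iff.2 ⟨w1.le, fun n => ?_⟩
  by_cases hn : n < N
  · exact (w2 n (Finset.mem_range.2 hn)).le
  · have h4 := Complex.abs_im_le_norm (w - c n)
    simp only [Complex.sub_im, Complex.ofReal_im, sub_zero] at h4
    linarith [hN n (not_lt.1 hn)]

theorem norm_lt_of_mem_interior (h : IsBeads K c r) {z : ℂ} (hz : z ∈ interior K) : ‖z‖ < 1 := by
  have h1 : z ∈ interior (closedBall (0 : ℂ) 1) :=
    interior_mono (fun w hw => by simpa using (h.mem_iff.1 hw).1) hz
  rw [interior_closedBall _ one_ne_zero] at h1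
  simpa using h1

theorem lt_of_mem_interior (h : IsBeads K c r) {z : ℂ} (hz : z ∈ interior K) (n : ℕ) :
    r n < ‖z - c n‖ := by
  by_contra! hle
  have h1 : z ∈ closure (ball (c n : ℂ) (r n)) := by
    rw [closure_ball _ (h.pos n).ne', mem_closedBall, dist_eq_norm]
    exact hle
  obtain ⟨w, hw, hw'⟩ := mem_closure_iff.1 h1 _ isOpen_interior hz
  have h2 := (h.mem_iff.1 (interior_subset hw)).2 n
  rw [mem_ball, dist_eq_norm] at hw'
  linarith

theorem mem_interior_iff (h : IsBeads K c r) {z : ℂ} (hz : z.im ≠ 0) :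
    z ∈ interior K ↔ ‖z‖ < 1 ∧ ∀ n, r n < ‖z - c n‖ :=
  ⟨fun hm => ⟨h.norm_lt_of_mem_interior hm, h.lt_of_mem_interior hm⟩,
    fun hm => h.mem_interior_of_im_ne_zero hz hm.1 hm.2⟩

theorem lowerPart_eq (h : IsBeads K c r) : lowerPart K = sidePart K (-1) := by
  ext z
  simp only [lowerPart, upperPart, sidePart, Set.mem_sdiff, mem_ofPred_eq, not_and, not_lt]
  constructor
  · rintro ⟨h1, h2⟩
    have := lt_of_le_of_ne (h2 h1) (h.im_ne_zero h1)
    exact ⟨h1, by linarith⟩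
  · rintro ⟨h1, h2⟩
    exact ⟨h1, fun _ => by linarith⟩

/-- On the imaginary axis negation is conjugation, and the beads are symmetric about the line. -/
theorem neg_mem_interior (h : IsBeads K c r) {y : ℝ} (hy : (Complex.I * y) ∈ interior K) :
    -(Complex.I * y) ∈ interior K := by
  have h0 := h.im_ne_zero hy
  rw [h.mem_interior_iff h0] at hy
  rw [h.mem_interior_iff (by simpa using h0)]
  refine ⟨by simpa using hy.1, fun n => (hy.2 n).trans_le (le_of_eq ?_)⟩
  have : -(Complex.I * y) - c n = (starRingEnd ℂ) (Complex.I * y - c n) := by simp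
  rw [this, Complex.norm_conj]

theorem norm_sq_sub (z : ℂ) (t : ℝ) :
    ‖z - t‖ ^ 2 = z.re ^ 2 + z.im ^ 2 - 2 * t * z.re + t ^ 2 := by
  rw [← Complex.normSq_eq_norm_sq, Complex.normSq_apply]
  simp
  ring

/-- In the coordinates `(Re z, |z|²)` each side of `int K` is convex. -/
theorem isPreconnected_sidePart (h : IsBeads K c r) {σ : ℝ} (hσ : σ ^ 2 = 1) :
    IsPreconnected (sidePart K σ) := by
  -- With `s = |z|²`, the conditions on the circles are affine in `(x, s)` and `x² < s` is convex.
  -- The map `φ` below recovers the height as `σ √(s - x²)`.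
  set C : Set (ℝ × ℝ) := {p | p.1 ^ 2 < p.2 ∧ p.2 < 1 ∧
    ∀ n, r n ^ 2 < p.2 - 2 * c n * p.1 + c n ^ 2} with hC
  have hconv : Convex ℝ C := by
    rintro ⟨x1, s1⟩ ⟨h1, h2, h3⟩ ⟨x2, s2⟩ ⟨h4, h5, h6⟩ a b ha hb hab
    simp only at h1 h2 h3 h4 h5 h6
    have hb' : b = 1 - a := by linarith
    subst hb'
    simp only [hC, mem_ofPred_eq, Prod.smul_mk, Prod.mk_add_mk, smul_eq_mul]
    rcases ha.eq_or_lt with rfl | ha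
    · simp only [zero_mul, zero_add, sub_zero, one_mul]
      exact ⟨h4, h5, h6⟩
    refine ⟨?_, ?_, fun n => ?_⟩
    · nlinarith [mul_pos ha (sub_pos.2 h1), mul_nonneg hb (sub_pos.2 h4).le,
        mul_nonneg (mul_nonneg ha.le hb) (sq_nonneg (x1 - x2))]
    · nlinarith [mul_pos ha (sub_pos.2 h2), mul_nonneg hb (sub_pos.2 h5).le]
    · nlinarith [mul_pos ha (sub_pos.2 (h3 n)), mul_nonneg hb (sub_pos.2 (h6 n)).le]
  set φ : ℝ × ℝ → ℂ := fun p => (p.1 : ℂ) + ((σ * Real.sqrt (p.2 - p.1 ^ 2) : ℝ) : ℂ) * Complex.I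
    with hφ
  have hφc : Continuous φ := by fun_prop
  have himg : sidePart K σ = φ '' C := by
    have key : ∀ p ∈ C, (φ p).re = p.1 ∧ (φ p).im ^ 2 = p.2 - p.1 ^ 2 ∧ 0 < σ * (φ p).im := by
      intro p hp
      have h1 : 0 < p.2 - p.1 ^ 2 := sub_pos.2 hp.1
      refine ⟨by simp [hφ], ?_, ?_⟩
      · simp only [hφ, Complex.add_im, Complex.ofReal_im, Complex.mul_im, Complex.ofReal_re,
          Complex.I_im, Complex.I_re]
        rw [show (0 + (σ * √(p.2 - p.1 ^ 2) * 1 + 0 * 0)) ^ 2 = σ ^ 2 * √(p.2 - p.1 ^ 2) ^ 2 by ring,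
          hσ, Real.sq_sqrt h1.le, one_mul]
      · simp only [hφ, Complex.add_im, Complex.ofReal_im, Complex.mul_im, Complex.ofReal_re,
          Complex.I_im, Complex.I_re]
        rw [show σ * (0 + (σ * √(p.2 - p.1 ^ 2) * 1 + 0 * 0)) = σ ^ 2 * √(p.2 - p.1 ^ 2) by ring,
          hσ, one_mul]
        exact Real.sqrt_pos.2 h1
    ext z
    constructor
    · rintro ⟨hz, hs⟩
      have hn : ‖z‖ ^ 2 = z.re ^ 2 + z.im ^ 2 := by simpa using norm_sq_sub z 0
      refine ⟨(z.re, ‖z‖ ^ 2), ⟨?_, ?_, fun n => ?_⟩, ?_⟩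
      · have : z.im ≠ 0 := h.im_ne_zero hz
        have := pow_pos (abs_pos.2 this) 2
        rw [sq_abs] at this
        simp only [hn]
        linarith
      · have := h.norm_lt_of_mem_interior hz
        simp only
        nlinarith [norm_nonneg z]
      · have h1 := h.lt_of_mem_interior hz n
        have h2 := norm_sq_sub z (c n)
        have h3 := h.pos n
        simp only [hn]
        nlinarith
      · have h1 : √(z.im ^ 2) = σ * z.im := by
          rw [Real.sqrt_eq_iff_mul_self_eq_of_pos hs]
          linear_combination z.im ^ 2 * hσ
        apply Complex.ext
        · simp [hφ]
        · simp only [hφ, hn, add_sub_cancel_left, h1, Complex.add_im, Complex.ofReal_im,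
            Complex.mul_im, Complex.ofReal_re, Complex.I_im, Complex.I_re]
          linear_combination z.im * hσ
    · rintro ⟨p, hp, rfl⟩
      obtain ⟨k1, k2, k3⟩ := key p hp
      have hi : (φ p).im ≠ 0 := by
        rintro h0
        simp [h0] at k3
      refine ⟨(h.mem_interior_iff hi).2 ⟨?_, fun n => ?_⟩, k3⟩
      · have := norm_sq_sub (φ p) 0
        simp only [Complex.ofReal_zero, sub_zero, k1, k2] at this
        have h2 := hp.2.1
        refine lt_of_pow_lt_pow_left₀ 2 zero_le_one ?_
        linarith
      · have := norm_sq_sub (φ p) (c n)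
        rw [k1, k2] at this
        have h2 := hp.2.2 n
        refine lt_of_pow_lt_pow_left₀ 2 (norm_nonneg _) ?_
        linarith
  rw [himg]
  exact hconv.isPreconnected.image φ hφc.continuousOn

/-- Off the line, membership in `int K` is given by strict inequalities alone, so a frontier point
turns one of them into an equality; the beads do not accumulate there. -/
theorem frontier_sidePart (h : IsBeads K c r) {σ : ℝ} {z : ℂ} (hz : z ∈ frontier (sidePart K σ))
    (h0 : z.im ≠ 0) : ‖z‖ = 1 ∨ ∃ n, ‖z - c n‖ = r n := by
  by_contra! hcon
  have hzK := h.mem_iff.1 (h.closure_sidePart_subset σ hz.1)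
  have h1 : z ∈ interior K := (h.mem_interior_iff h0).2
    ⟨lt_of_le_of_ne hzK.1 hcon.1, fun n => lt_of_le_of_ne (hzK.2 n) (hcon.2 n).symm⟩
  have h2 : 0 ≤ σ * z.im := closure_sidePart_le hz.1
  rw [(isOpen_sidePart K σ).frontier_eq] at hz
  rcases h2.eq_or_lt with h3 | h3
  · rcases mul_eq_zero.1 h3.symm with h4 | h4
    · have : sidePart K σ = ∅ := by
        ext w
        simp [sidePart, h4]
      rw [this] at hz
      simp at hz
    · exact h0 h4
  · exact hz.2 ⟨h1, h3⟩

/-- Almost every real point of `K` is the vertex of a double cone in `int K`. -/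
theorem ae_cone_subset (h : IsBeads K c r) : ∀ᵐ x : ℝ, (x : ℂ) ∈ K → ∃ δ > 0, ∀ z : ℂ,
    z.im ≠ 0 → |z.re - x| ≤ 2 * |z.im| → |z.im| < δ → z ∈ interior K := by
  -- Borel–Cantelli, as the radii are summable: almost every `x` lies in only finitely many of the
  -- tripled intervals.
  have h1 : ∀ᵐ x : ℝ, ∀ᶠ n in atTop, x ∉ closedBall (c n) (3 * r n) := by
    apply ae_eventually_notMem
    have : ∀ n, volume (closedBall (c n) (3 * r n)) = 6 * ENNReal.ofReal (r n) := by
      intro n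
      rw [Real.volume_closedBall, ← mul_assoc, ENNReal.ofReal_mul (by norm_num)]
      norm_num
    simp_rw [this, ENNReal.tsum_mul_left]
    exact ENNReal.mul_ne_top (by norm_num) h.tsum_ne_top
  -- Dropping countably many end points makes the inequalities at `x` strict, hence stable near `x`
  -- for the finitely many remaining beads.
  have h2 : ∀ᵐ x : ℝ, x ∉ ({1, -1} ∪ range (fun n => c n + r n) ∪ range fun n => c n - r n) := by
    apply Set.Countable.ae_notMem
    exact (((Set.toFinite _).countable).union (countable_range _)).union (countable_range _)
  filter_upwards [h1, h2] with x hx1 hx2 hxK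
  simp only [mem_union, mem_insert_iff, mem_singleton_iff, mem_range, not_or, not_exists] at hx2
  obtain ⟨⟨⟨ha, hb⟩, hc⟩, hd⟩ := hx2
  obtain ⟨hn, hm⟩ := h.mem_iff.1 hxK
  have hx3 : ‖(x : ℂ)‖ < 1 := by
    refine lt_of_le_of_ne hn fun he => ?_
    rw [Complex.norm_real, Real.norm_eq_abs] at he
    rcases eq_or_eq_neg_of_abs_eq he with h' | h'
    exacts [ha h', hb h']
  have hx4 : ∀ n, r n < ‖(x : ℂ) - c n‖ := by
    intro n
    refine lt_of_le_of_ne (hm n) fun he => ?_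
    rw [← Complex.ofReal_sub, Complex.norm_real, Real.norm_eq_abs] at he
    rcases eq_or_eq_neg_of_abs_eq he.symm with h' | h'
    · exact hc n (by linarith)
    · exact hd n (by linarith)
  obtain ⟨N, hN⟩ := eventually_atTop.1 hx1
  have e1 : ∀ᶠ w : ℂ in 𝓝 (x : ℂ), ‖w‖ < 1 :=
    (continuous_norm (E := ℂ)).continuousAt.eventually_lt_const hx3
  have e2 : ∀ᶠ w : ℂ in 𝓝 (x : ℂ), ∀ n ∈ Finset.range N, r n < ‖w - c n‖ := by
    rw [Filter.eventually_all_finset]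
    intro n _
    have : Continuous fun w : ℂ => ‖w - c n‖ := by fun_prop
    exact this.continuousAt.eventually_const_lt (hx4 n)
  obtain ⟨ε, hε, hball⟩ := Metric.eventually_nhds_iff.1 (e1.and e2)
  -- In the cone `|z - x| ≤ 3 |Im z|`.
  refine ⟨ε / 3, by positivity, fun z hz hz1 hz2 => ?_⟩
  have hd : dist z x < ε := by
    rw [dist_eq_norm]
    refine lt_of_le_of_lt (Complex.norm_le_abs_re_add_abs_im _) ?_
    simp only [Complex.sub_re, Complex.ofReal_re, Complex.sub_im, Complex.ofReal_im, sub_zero]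
    linarith
  obtain ⟨g1, g2⟩ := hball hd
  refine (h.mem_interior_iff hz).2 ⟨g1, fun n => ?_⟩
  by_cases hn : n < N
  · exact g2 n (Finset.mem_range.2 hn)
  -- A point of the cone in bead `n` has `|Re z - x| ≤ 2 |Im z| ≤ 2 r n` and `|Re z - c n| ≤ r n`,
  -- so `|x - c n| ≤ 3 r n`.
  · by_contra! hle
    refine hN n (not_lt.1 hn) ?_
    have i1 := (Complex.abs_re_le_norm (z - c n)).trans hle
    have i2 := (Complex.abs_im_le_norm (z - c n)).trans hle
    simp only [Complex.sub_re, Complex.ofReal_re, Complex.sub_im, Complex.ofReal_im, sub_zero]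
      at i1 i2
    rw [mem_closedBall, Real.dist_eq]
    have := abs_sub_le x z.re (c n)
    rw [abs_sub_comm x z.re] at this
    linarith

end IsBeads

/-! ### Cauchy transforms -/

/-- The map `p` lets one statement serve harmonic measure in the plane (`p` the identity) and length
on the line (`p` the inclusion). -/
theorem differentiableAt_cauchy {α : Type*} [MeasurableSpace α] {ν : Measure α} {p g : α → ℂ}
    {S : Set ℂ} (hS : IsClosed S) (hp : AEStronglyMeasurable p ν) (hpS : ∀ᵐ x ∂ν, p x ∈ S)
    (hg : Integrable g ν) {z : ℂ} (hz : z ∉ S) :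
    DifferentiableAt ℂ (fun w => ∫ x, g x * (p x - w)⁻¹ ∂ν) z := by
  obtain ⟨ε, hε, hball⟩ := Metric.isOpen_iff.1 hS.isOpen_compl z hz
  have hfar : ∀ w ∈ ball z (ε / 2), ∀ s ∈ S, ε / 2 ≤ ‖s - w‖ := by
    intro w hw s hs
    by_contra! hlt
    refine hball (show s ∈ ball z ε from ?_) hs
    rw [mem_ball]
    have := dist_triangle s w z
    rw [dist_eq_norm s w] at this
    linarith [mem_ball.1 hw]
  have hmeas : ∀ w, AEStronglyMeasurable (fun x => (p x - w)⁻¹) ν := fun w =>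
    (measurable_inv.comp_aemeasurable (hp.aemeasurable.sub_const w)).aestronglyMeasurable
  have hzb : z ∈ ball z (ε / 2) := mem_ball_self (by positivity)
  refine (hasDerivAt_integral_of_dominated_loc_of_deriv_le
    (F' := fun w x => g x * ((p x - w)⁻¹ * (p x - w)⁻¹))
    (bound := fun x => ‖g x‖ * ((ε / 2)⁻¹ * (ε / 2)⁻¹)) (ball_mem_nhds z (half_pos hε))
    (Eventually.of_forall fun w => hg.aestronglyMeasurable.mul (hmeas w)) ?_
    (hg.aestronglyMeasurable.mul ((hmeas z).mul (hmeas z))) ?_ (hg.norm.mul_const _)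
    ?_).2.differentiableAt
  · refine hg.mul_bdd (c := (ε / 2)⁻¹) (hmeas z) ?_
    filter_upwards [hpS] with x hx
    rw [norm_inv]
    exact inv_anti₀ (half_pos hε) (hfar z hzb _ hx)
  · filter_upwards [hpS] with x hx w hw
    rw [norm_mul, norm_mul, norm_inv]
    have := inv_anti₀ (half_pos hε) (hfar w hw _ hx)
    gcongr
  · filter_upwards [hpS] with x hx w hw
    have hne : p x - w ≠ 0 := norm_pos_iff.1 ((half_pos hε).trans_le (hfar w hw _ hx))
    have h1 : HasDerivAt (fun w => p x - w) (-1) w := by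
      simpa using (hasDerivAt_id w).const_sub (p x)
    have h2 := (h1.inv hne).const_mul (g x)
    refine h2.congr_deriv ?_
    field_simp

/-! ### Measures representing a point for analytic functions -/

section Represent

variable {G : Set ℂ} {a : ℂ} {μ : Measure ℂ} {q : ℂ → ℂ}

theorem IsHarmonicMeasure.ae_mem_frontier (hμ : IsHarmonicMeasure G a μ) :
    ∀ᵐ ζ ∂μ, ζ ∈ frontier G :=
  hμ.measure_compl_frontier

theorem IsHarmonicMeasure.restrict_frontier (hμ : IsHarmonicMeasure G a μ) :
    μ.restrict (frontier G) = μ :=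
  Measure.restrict_eq_self_of_ae_mem hμ.ae_mem_frontier

theorem IsHarmonicMeasure.integrable (hμ : IsHarmonicMeasure G a μ) (hb : Bornology.IsBounded G)
    (hq : ContinuousOn q (closure G)) : Integrable q μ := by
  have := hμ.isProbabilityMeasure
  have hK : IsCompact (frontier G) :=
    hb.isCompact_closure.of_isClosed_subset isClosed_frontier frontier_subset_closure
  rw [← hμ.restrict_frontier]
  exact (hq.mono frontier_subset_closure).integrableOn_compact hK

theorem IsHarmonicMeasure.integral_analytic (hμ : IsHarmonicMeasure G a μ) (hG : IsOpen G)
    (hb : Bornology.IsBounded G) (hq : DiffContOnCl ℂ q G) : ∫ ζ, q ζ ∂μ = q a := by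
  have hint := hμ.integrable hb hq.continuousOn
  have han : ∀ z ∈ G, AnalyticAt ℂ q z := fun z hz =>
    hq.differentiableOn.analyticAt (hG.mem_nhds hz)
  have h1 := hμ.integral_eq (fun z => (q z).re)
    ⟨fun z hz => (han z hz).harmonicAt_re, Complex.continuous_re.comp_continuousOn hq.continuousOn⟩
  have h2 := hμ.integral_eq (fun z => (q z).im)
    ⟨fun z hz => (han z hz).harmonicAt_im, Complex.continuous_im.comp_continuousOn hq.continuousOn⟩
  have h3 := Complex.reCLM.integral_comp_comm hint
  have h4 := Complex.imCLM.integral_comp_comm hint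
  simp only [Complex.reCLM_apply, Complex.imCLM_apply] at h3 h4
  exact Complex.ext (h3.symm.trans h1) (h4.symm.trans h2)

/-- The Cauchy transform of `(ζ - a) μ`. -/
def cauchyWeight (μ : Measure ℂ) (a z : ℂ) : ℂ := ∫ ζ, (ζ - a) * (ζ - z)⁻¹ ∂μ

theorem sub_ne_zero_of_mem_frontier (hG : IsOpen G) {z ζ : ℂ} (hz : z ∈ G)
    (hζ : ζ ∈ frontier G) : ζ - z ≠ 0 := by
  intro h
  rw [sub_eq_zero] at h
  rw [hG.frontier_eq, h] at hζ
  exact hζ.2 hz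

theorem continuousOn_inv_sub {S : Set ℂ} {z : ℂ} (hz : z ∉ S) :
    ContinuousOn (fun ζ : ℂ => (ζ - z)⁻¹) S :=
  ContinuousOn.inv₀ (by fun_prop) fun ζ hζ => sub_ne_zero.2 fun h => hz (h ▸ hζ)

theorem IsHarmonicMeasure.integrable_mul_inv (hμ : IsHarmonicMeasure G a μ)
    (hb : Bornology.IsBounded G) (hq : ContinuousOn q (closure G)) {z : ℂ}
    (hz : z ∉ frontier G) : Integrable (fun ζ => q ζ * ((ζ - a) * (ζ - z)⁻¹)) μ := by
  have := hμ.isProbabilityMeasure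
  have hK : IsCompact (frontier G) :=
    hb.isCompact_closure.of_isClosed_subset isClosed_frontier frontier_subset_closure
  rw [← hμ.restrict_frontier]
  exact ContinuousOn.integrableOn_compact hK ((hq.mono frontier_subset_closure).mul
    (ContinuousOn.mul (by fun_prop) (continuousOn_inv_sub hz)))

/-- The difference quotient of `q` at `z`, times `w - a`, is analytic and vanishes at `a`, so its
`μ`-integral is zero. This is the role of the factor `ζ - a`. -/
theorem IsHarmonicMeasure.mul_cauchyWeight (hμ : IsHarmonicMeasure G a μ) (hG : IsOpen G)
    (hb : Bornology.IsBounded G) (hq : DiffContOnCl ℂ q G) {z : ℂ} (hz : z ∈ G) :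
    q z * cauchyWeight μ a z = ∫ ζ, q ζ * ((ζ - a) * (ζ - z)⁻¹) ∂μ := by
  have hzf : z ∉ frontier G := by
    rw [hG.frontier_eq]; exact fun h => h.2 hz
  have hnhds : G ∈ 𝓝 z := hG.mem_nhds hz
  have hds : DiffContOnCl ℂ (fun w => dslope q z w * (w - a)) G := by
    refine ⟨?_, ?_⟩
    · exact ((Complex.differentiableOn_dslope hnhds).2 hq.differentiableOn).mul (by fun_prop)
    · refine ContinuousOn.mul ?_ (by fun_prop)
      exact (continuousOn_dslope (mem_of_superset hnhds subset_closure)).2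
        ⟨hq.continuousOn, hq.differentiableAt hG hz⟩
  have h1 := hμ.integral_analytic hG hb hds
  simp only [sub_self, mul_zero] at h1
  have h2 : ∫ ζ, dslope q z ζ * (ζ - a) ∂μ
      = ∫ ζ, (q ζ * ((ζ - a) * (ζ - z)⁻¹) - q z * ((ζ - a) * (ζ - z)⁻¹)) ∂μ := by
    refine integral_congr_ae ?_
    filter_upwards [hμ.ae_mem_frontier] with ζ hζ
    have hne := sub_ne_zero_of_mem_frontier hG hz hζ
    rw [dslope_of_ne _ (sub_ne_zero.1 hne), slope_def_field]
    field_simp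
  rw [h2, integral_sub (hμ.integrable_mul_inv hb hq.continuousOn hzf)
    (hμ.integrable_mul_inv hb continuousOn_const hzf), integral_const_mul, sub_eq_zero] at h1
  exact h1.symm

/-- For `z` off the closure the integrand is itself analytic in `G` and vanishes at `a`. -/
theorem IsHarmonicMeasure.cauchy_eq_zero (hμ : IsHarmonicMeasure G a μ) (hG : IsOpen G)
    (hb : Bornology.IsBounded G) (hq : DiffContOnCl ℂ q G) {z : ℂ} (hz : z ∉ closure G) :
    ∫ ζ, q ζ * ((ζ - a) * (ζ - z)⁻¹) ∂μ = 0 := by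
  have hds : DiffContOnCl ℂ (fun w => q w * ((w - a) * (w - z)⁻¹)) G := by
    refine ⟨?_, ?_⟩
    · refine hq.differentiableOn.mul (DifferentiableOn.mul (by fun_prop) ?_)
      refine DifferentiableOn.inv (by fun_prop) fun w hw => sub_ne_zero.2 ?_
      exact fun h => hz (h ▸ subset_closure hw)
    · exact hq.continuousOn.mul (ContinuousOn.mul (by fun_prop) (continuousOn_inv_sub hz))
  simpa using hμ.integral_analytic hG hb hds

theorem IsHarmonicMeasure.analyticOnNhd_cauchyWeight (hμ : IsHarmonicMeasure G a μ)
    (hG : IsOpen G) (hb : Bornology.IsBounded G) : AnalyticOnNhd ℂ (cauchyWeight μ a) G := by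
  refine DifferentiableOn.analyticOnNhd (fun z hz => ?_) hG
  refine (differentiableAt_cauchy (S := frontier G) isClosed_frontier
    aestronglyMeasurable_id hμ.ae_mem_frontier
    (hμ.integrable hb (q := fun ζ => ζ - a) (by fun_prop)) ?_).differentiableWithinAt
  rw [hG.frontier_eq]
  exact fun h => h.2 hz

theorem IsHarmonicMeasure.cauchyWeight_self (hμ : IsHarmonicMeasure G a μ) (hG : IsOpen G)
    (ha : a ∈ G) : cauchyWeight μ a a = 1 := by
  have := hμ.isProbabilityMeasure
  have : ∫ ζ, (ζ - a) * (ζ - a)⁻¹ ∂μ = ∫ _, (1 : ℂ) ∂μ := by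
    refine integral_congr_ae ?_
    filter_upwards [hμ.ae_mem_frontier] with ζ hζ
    exact mul_inv_cancel₀ (sub_ne_zero_of_mem_frontier hG ha hζ)
  simp [cauchyWeight, this]

/-- Points of a domain are analytic bounded point evaluations for the `L¹` norm of a
representing measure. -/
theorem IsHarmonicMeasure.exists_norm_le (hμ : IsHarmonicMeasure G a μ) (hG : IsOpen G)
    (hb : Bornology.IsBounded G) (hconn : IsPreconnected G) (ha : a ∈ G) {z₀ : ℂ} (hz₀ : z₀ ∈ G) :
    ∃ ρ > 0, ∃ M > 0, ball z₀ ρ ⊆ G ∧ ∀ z ∈ ball z₀ ρ, ∀ q : ℂ → ℂ, DiffContOnCl ℂ q G →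
      ‖q z‖ ≤ M * ∫ ζ, ‖q ζ‖ ∂μ := by
  have hprob := hμ.isProbabilityMeasure
  have han := hμ.analyticOnNhd_cauchyWeight hG hb
  -- The weight equals `1` at `a`, so by the identity theorem its zeros are isolated.
  have hev : ∀ᶠ z in 𝓝[≠] z₀, cauchyWeight μ a z ≠ 0 := by
    by_contra hcon
    have hfr : ∃ᶠ z in 𝓝[≠] z₀, cauchyWeight μ a z = 0 := by
      simpa only [ne_eq, not_not] using not_eventually.1 hcon
    have := han.eqOn_zero_of_preconnected_of_frequently_eq_zero hconn hz₀ hfr ha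
    rw [hμ.cauchyWeight_self hG ha] at this
    simp at this
  rw [eventually_nhdsWithin_iff] at hev
  obtain ⟨ε, hε, hball⟩ := Metric.eventually_nhds_iff_ball.1 (hev.and (hG.eventually_mem hz₀))
  set ρ := ε / 2 with hρ
  have hρ0 : 0 < ρ := half_pos hε
  have hcl : closedBall z₀ ρ ⊆ ball z₀ ε := closedBall_subset_ball (half_lt_self hε)
  have hclG : closedBall z₀ ρ ⊆ G := fun z hz => (hball z (hcl hz)).2
  have hsG : sphere z₀ ρ ⊆ G := sphere_subset_closedBall.trans hclG
  have hcpt : IsCompact (sphere z₀ ρ) := isCompact_sphere z₀ ρ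
  have hne : (sphere z₀ ρ).Nonempty := NormedSpace.sphere_nonempty.2 hρ0.le
  obtain ⟨w, hw, hwmin⟩ := hcpt.exists_isMinOn hne
    ((han.continuousOn.mono hsG).norm)
  have hwpos : 0 < ‖cauchyWeight μ a w‖ :=
    norm_pos_iff.2 ((hball w (hcl (sphere_subset_closedBall hw))).1 (by
      rintro rfl
      rw [mem_sphere, dist_self] at hw
      exact hρ0.ne hw))
  have hfar : ∀ z ∈ sphere z₀ ρ, ∀ ζ ∈ frontier G, ρ ≤ ‖ζ - z‖ := by
    intro z hz ζ hζ
    by_contra! hlt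
    have : ζ ∈ ball z₀ ε := by
      rw [mem_ball]
      have := dist_triangle ζ z z₀
      rw [dist_eq_norm ζ z, mem_sphere.1 hz] at this
      linarith
    rw [hG.frontier_eq] at hζ
    exact hζ.2 (hball ζ this).2
  obtain ⟨R, hR⟩ := hb.closure.exists_norm_le
  have hR0 : 0 ≤ R := (norm_nonneg _).trans (hR a (subset_closure ha))
  -- `2 * R` bounds `|ζ - a|` and `ρ⁻¹` the Cauchy kernel on the circle; the summand `1` only
  -- ensures positivity.
  refine ⟨ρ, hρ0, (2 * R * ρ⁻¹) / ‖cauchyWeight μ a w‖ + 1, by positivity,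
    ball_subset_closedBall.trans hclG, fun z hz q hq => ?_⟩
  have hI : 0 ≤ ∫ ζ, ‖q ζ‖ ∂μ := integral_nonneg fun _ => norm_nonneg _
  have hsph : ∀ z ∈ sphere z₀ ρ, ‖q z‖ ≤ (2 * R * ρ⁻¹) / ‖cauchyWeight μ a w‖ * ∫ ζ, ‖q ζ‖ ∂μ := by
    intro z hz
    have h1 := hμ.mul_cauchyWeight hG hb hq (hsG hz)
    have h2 : ‖∫ ζ, q ζ * ((ζ - a) * (ζ - z)⁻¹) ∂μ‖ ≤ ∫ ζ, 2 * R * ρ⁻¹ * ‖q ζ‖ ∂μ := by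
      refine norm_integral_le_of_norm_le ((hμ.integrable hb hq.continuousOn).norm.const_mul _) ?_
      filter_upwards [hμ.ae_mem_frontier] with ζ hζ
      rw [norm_mul, norm_mul, norm_inv, mul_comm]
      have h3 := inv_anti₀ hρ0 (hfar z hz ζ hζ)
      have h4 : ‖ζ - a‖ ≤ 2 * R := by
        have := norm_sub_le ζ a
        linarith [hR a (subset_closure ha), hR ζ (frontier_subset_closure hζ)]
      gcongr
    rw [← h1, norm_mul, integral_const_mul] at h2
    have h5 : ‖cauchyWeight μ a w‖ ≤ ‖cauchyWeight μ a z‖ := hwmin hz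
    rw [div_mul_eq_mul_div, le_div_iff₀ hwpos]
    exact (mul_le_mul_of_nonneg_left h5 (norm_nonneg _)).trans h2
  have hfin : ‖q z‖ ≤ (2 * R * ρ⁻¹) / ‖cauchyWeight μ a w‖ * ∫ ζ, ‖q ζ‖ ∂μ := by
    -- The weight may vanish at `z₀`, so the bound is carried from the circle to the disk by the
    -- maximum principle.
    refine Complex.norm_le_of_forall_mem_frontier_norm_le (U := ball z₀ ρ) isBounded_ball
      (hq.mono (ball_subset_closedBall.trans hclG)) ?_ (subset_closure hz)
    rw [frontier_ball _ hρ0.ne']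
    exact hsph
  linarith

end Represent

/-! ### Rational functions -/

theorem diffContOnCl_of_mem_ratFunctions {K G : Set ℂ} (hK : closure G ⊆ K) {q : ℂ → ℂ}
    (hq : q ∈ ratFunctions K) : DiffContOnCl ℂ q G := by
  obtain ⟨p, d, hd, rfl⟩ := hq
  have hdiff : DifferentiableOn ℂ (fun z => p.eval z / d.eval z) (closure G) :=
    fun z hz => ((p.differentiableAt).div d.differentiableAt (hd z (hK hz))).differentiableWithinAt
  exact ⟨hdiff.mono subset_closure, hdiff.continuousOn⟩

theorem measurable_of_mem_ratFunctions {K : Set ℂ} {q : ℂ → ℂ} (hq : q ∈ ratFunctions K) :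
    Measurable q := by
  obtain ⟨p, d, -, rfl⟩ := hq
  exact p.continuous.measurable.div d.continuous.measurable

theorem exists_bound_of_mem_ratFunctions {K : Set ℂ} (hK : IsCompact K) {q : ℂ → ℂ}
    (hq : q ∈ ratFunctions K) : ∃ C, ∀ z ∈ K, ‖q z‖ ≤ C := by
  obtain ⟨p, d, hd, rfl⟩ := hq
  exact hK.exists_bound_of_continuousOn (p.continuous.continuousOn.div d.continuous.continuousOn hd)

theorem memLp_of_mem_ratFunctions {K : Set ℂ} (hK : IsCompact K) {q : ℂ → ℂ}
    (hq : q ∈ ratFunctions K) {ω : Measure ℂ} [IsFiniteMeasure ω] (hω : ∀ᵐ z ∂ω, z ∈ K)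
    (t : ℝ≥0∞) : MemLp q t ω := by
  obtain ⟨C, hC⟩ := exists_bound_of_mem_ratFunctions hK hq
  exact MemLp.of_bound (measurable_of_mem_ratFunctions hq).aestronglyMeasurable C
    (hω.mono fun z hz => hC z hz)

theorem integral_norm_le_eLpNorm {μ ω : Measure ℂ} [IsProbabilityMeasure μ] (hle : μ ≤ ω)
    {f : ℂ → ℂ} (hf : MemLp f 2 ω) : ∫ ζ, ‖f ζ‖ ∂μ ≤ (eLpNorm f 2 ω).toReal := by
  have h1 : MemLp f 2 μ := hf.mono_measure hle
  rw [integral_norm_eq_lintegral_enorm h1.aestronglyMeasurable, ← eLpNorm_one_eq_lintegral_enorm]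
  refine ENNReal.toReal_mono hf.eLpNorm_lt_top.ne ?_
  exact (eLpNorm_le_eLpNorm_of_exponent_le one_le_two h1.aestronglyMeasurable).trans
    (eLpNorm_mono_measure f hle)

/-! ### The Poisson kernel of a half plane -/

/-- The Poisson kernel (times `π`) of the half plane containing `w`. -/
def linePoisson (w : ℂ) (t : ℝ) : ℝ := |w.im| / ‖(t : ℂ) - w‖ ^ 2

theorem norm_sq_ofReal_sub (w : ℂ) (t : ℝ) : ‖(t : ℂ) - w‖ ^ 2 = (t - w.re) ^ 2 + w.im ^ 2 := by
  rw [← Complex.normSq_eq_norm_sq, Complex.normSq_apply]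
  simp
  ring

theorem linePoisson_nonneg (w : ℂ) (t : ℝ) : 0 ≤ linePoisson w t := by
  unfold linePoisson; positivity

theorem linePoisson_eq {w : ℂ} (hw : w.im ≠ 0) (t : ℝ) :
    linePoisson w t = |w.im|⁻¹ * (1 + ((t - w.re) / |w.im|) ^ 2)⁻¹ := by
  have h := abs_pos.2 hw
  rw [linePoisson, norm_sq_ofReal_sub, ← sq_abs w.im]
  field_simp
  ring

theorem linePoisson_le {w : ℂ} (hw : w.im ≠ 0) (t : ℝ) : linePoisson w t ≤ |w.im|⁻¹ := by
  rw [linePoisson_eq hw]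
  refine mul_le_of_le_one_right (by positivity) (inv_le_one_of_one_le₀ ?_)
  nlinarith [sq_nonneg ((t - w.re) / |w.im|)]

theorem integrable_linePoisson {w : ℂ} (hw : w.im ≠ 0) : Integrable (linePoisson w) := by
  have h := abs_pos.2 hw
  have h1 := ((integrable_inv_one_add_sq.comp_div h.ne').comp_sub_right w.re).const_mul |w.im|⁻¹
  exact h1.congr (Eventually.of_forall fun t => (linePoisson_eq hw t).symm)

theorem integral_linePoisson {w : ℂ} (hw : w.im ≠ 0) : ∫ t, linePoisson w t = Real.pi := by
  have h := abs_pos.2 hw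
  simp_rw [linePoisson_eq hw]
  rw [integral_const_mul, integral_sub_right_eq_self (fun t => (1 + (t / |w.im|) ^ 2)⁻¹),
    Measure.integral_comp_div (fun t => (1 + t ^ 2)⁻¹), integral_univ_inv_one_add_sq, abs_abs,
    smul_eq_mul, inv_mul_cancel_left₀ h.ne']

theorem intervalIntegral_linePoisson {w : ℂ} (hw : w.im ≠ 0) (a b : ℝ) :
    ∫ t in a..b, linePoisson w t
      = Real.arctan ((b - w.re) / |w.im|) - Real.arctan ((a - w.re) / |w.im|) := by
  have h := abs_pos.2 hw
  simp_rw [linePoisson_eq hw]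
  rw [intervalIntegral.integral_const_mul,
    intervalIntegral.integral_comp_sub_right (fun t => (1 + (t / |w.im|) ^ 2)⁻¹),
    intervalIntegral.integral_comp_div (fun t => (1 + t ^ 2)⁻¹) h.ne', integral_inv_one_add_sq,
    smul_eq_mul, inv_mul_cancel_left₀ h.ne']

/-- Thales' theorem: a diameter is seen from the circle at a right angle. -/
theorem setIntegral_linePoisson_diameter {w : ℂ} (hw : w.im ≠ 0) {c ρ : ℝ}
    (h : ‖w - c‖ = ρ) : ∫ t in Ioc (c - ρ) (c + ρ), linePoisson w t = Real.pi / 2 := by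
  have hy := abs_pos.2 hw
  have hρ : 0 ≤ ρ := h ▸ norm_nonneg _
  have h1 : (w.re - c) ^ 2 + |w.im| ^ 2 = ρ ^ 2 := by
    have := norm_sq_ofReal_sub w c
    rw [norm_sub_rev, h] at this
    rw [sq_abs]; linarith
  have h2 : 0 < c + ρ - w.re := by
    have : w.re - c < ρ := lt_of_pow_lt_pow_left₀ 2 hρ (by nlinarith)
    linarith
  -- The right angle at `w`: the two slopes are negative reciprocals.
  have h3 : (c - ρ - w.re) / |w.im| = -((c + ρ - w.re) / |w.im|)⁻¹ := by
    field_simp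
    linarith
  rw [← intervalIntegral.integral_of_le (by linarith), intervalIntegral_linePoisson hw, h3,
    Real.arctan_neg, Real.arctan_inv_of_pos (by positivity)]
  ring

theorem setIntegral_linePoisson_le_pi {w : ℂ} (hw : w.im ≠ 0) (E : Set ℝ) :
    ∫ t in E, linePoisson w t ≤ Real.pi := by
  rw [← integral_linePoisson hw]
  exact setIntegral_le_integral (integrable_linePoisson hw)
    (Eventually.of_forall fun t => linePoisson_nonneg w t)

theorem setIntegral_linePoisson_mono {w : ℂ} (hw : w.im ≠ 0) {E E' : Set ℝ} (h : E ≤ᵐ[volume] E') :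
    ∫ t in E, linePoisson w t ≤ ∫ t in E', linePoisson w t :=
  setIntegral_mono_set (integrable_linePoisson hw).integrableOn
    (Eventually.of_forall fun t => linePoisson_nonneg w t) h

theorem setIntegral_linePoisson_le_of_subset {w : ℂ} (hw : w.im ≠ 0) {c ρ : ℝ} (h : ‖w - c‖ = ρ)
    {E : Set ℝ} (hE : E ⊆ Icc (c - ρ) (c + ρ)) : ∫ t in E, linePoisson w t ≤ Real.pi / 2 := by
  rw [← setIntegral_linePoisson_diameter hw h]
  exact setIntegral_linePoisson_mono hw (hE.eventuallyLE.trans Ioc_ae_eq_Icc.symm.le)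

/-- The total integral is `π` and the diameter takes exactly half of it. -/
theorem setIntegral_linePoisson_le_of_disjoint {w : ℂ} (hw : w.im ≠ 0) {c ρ : ℝ} (h : ‖w - c‖ = ρ)
    {E : Set ℝ} (hE : Disjoint E (Ioo (c - ρ) (c + ρ))) :
    ∫ t in E, linePoisson w t ≤ Real.pi / 2 := by
  have h1 := integral_add_compl (s := Ioc (c - ρ) (c + ρ)) measurableSet_Ioc
    (integrable_linePoisson hw)
  rw [setIntegral_linePoisson_diameter hw h, integral_linePoisson hw] at h1
  have h2 : E ≤ᵐ[volume] (Ioc (c - ρ) (c + ρ))ᶜ := by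
    have : (Ioo (c - ρ) (c + ρ))ᶜ =ᵐ[volume] (Ioc (c - ρ) (c + ρ))ᶜ :=
      Ioo_ae_eq_Ioc.compl
    exact (subset_compl_iff_disjoint_right.2 hE).eventuallyLE.trans this.le
  refine (setIntegral_linePoisson_mono hw h2).trans ((eq_sub_of_add_eq' h1).le.trans ?_)
  linarith

/-- The Poisson integral of a set is large near its density points. -/
theorem eventually_lt_setIntegral_linePoisson {E : Set ℝ} (hE : MeasurableSet E) {x : ℝ}
    (hx : Tendsto (fun s => volume (E ∩ closedBall x s) / volume (closedBall x s)) (𝓝[>] 0) (𝓝 1)) :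
    ∀ᶠ s : ℝ in 𝓝[>] 0, ∀ w : ℂ, w.re = x → |w.im| = s →
      Real.pi / 2 < ∫ t in E, linePoisson w t := by
  -- An interval of radius `2s` seen from height `s` above its centre contributes `2 arctan 2`; `δ`
  -- is the excess over `π/2`.
  set δ : ℝ := 2 * Real.arctan 2 - Real.pi / 2 with hδ
  have hδ0 : 0 < δ := by
    have := Real.arctan_strictMono (show (1 : ℝ) < 2 by norm_num)
    rw [Real.arctan_one] at this
    linarith
  have h2 : Tendsto (fun s : ℝ => 2 * s) (𝓝[>] 0) (𝓝[>] 0) := by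
    refine tendsto_nhdsWithin_iff.2 ⟨?_, ?_⟩
    · have : Tendsto (fun s : ℝ => 2 * s) (𝓝 0) (𝓝 (2 * 0)) := by
        exact (continuous_const.mul continuous_id).tendsto 0
      rw [mul_zero] at this
      exact this.mono_left nhdsWithin_le_nhds
    · filter_upwards [self_mem_nhdsWithin] with s hs
      have : (0 : ℝ) < s := hs
      exact mem_Ioi.2 (by positivity)
  -- With this density, `E` misses length at most `(δ/8)(4s)` of the interval. The kernel is at most
  -- `1/s`, so the loss is at most `δ/2`.
  have h3 : ∀ᶠ s : ℝ in 𝓝[>] 0, ENNReal.ofReal (1 - δ / 8) <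
      volume (E ∩ closedBall x s) / volume (closedBall x s) := by
    refine hx.eventually_const_lt ?_
    rw [ENNReal.ofReal_lt_one]
    linarith
  filter_upwards [h2.eventually h3, self_mem_nhdsWithin] with s hs hs0 w hw1 hw2
  have hs0 : 0 < s := hs0
  have hw : w.im ≠ 0 := abs_pos.1 (hw2 ▸ hs0)
  rw [Real.volume_closedBall, ENNReal.lt_div_iff_mul_lt (Or.inl (by simpa using hs0))
    (Or.inl ENNReal.ofReal_ne_top)] at hs
  have hfin : volume (E ∩ closedBall x (2 * s)) ≠ ∞ :=
    ne_top_of_le_ne_top measure_closedBall_lt_top.ne (measure_mono inter_subset_right)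
  have h4 : (1 - δ / 8) * (2 * (2 * s)) < volume.real (E ∩ closedBall x (2 * s)) := by
    rw [← ENNReal.ofReal_mul' (by positivity)] at hs
    have hnn : 0 ≤ (1 - δ / 8) * (2 * (2 * s)) := by
      have := Real.arctan_lt_pi_div_two 2
      have := Real.pi_lt_four
      exact mul_nonneg (by linarith) (by positivity)
    exact (ENNReal.ofReal_lt_iff_lt_toReal hnn hfin).1 hs
  have h5 : ∫ t in closedBall x (2 * s), linePoisson w t = 2 * Real.arctan 2 := by
    rw [Real.closedBall_eq_Icc, integral_Icc_eq_integral_Ioc,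
      ← intervalIntegral.integral_of_le (by linarith), intervalIntegral_linePoisson hw, hw1, hw2]
    rw [show (x + 2 * s - x) / s = 2 by field_simp; ring,
      show (x - 2 * s - x) / s = -2 by field_simp; ring, Real.arctan_neg]
    ring
  have h6 := integral_inter_add_sdiff (s := closedBall x (2 * s)) hE
    (integrable_linePoisson hw).integrableOn
  have h7 := measureReal_inter_add_sdiff (μ := volume) (s := closedBall x (2 * s)) hE
    measure_closedBall_lt_top.ne
  rw [inter_comm, measureReal_def volume (closedBall x (2 * s)), Real.volume_closedBall,
    ENNReal.toReal_ofReal (by positivity)] at h7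
  have h8 : ∫ t in closedBall x (2 * s) \ E, linePoisson w t
      ≤ s⁻¹ * volume.real (closedBall x (2 * s) \ E) := by
    have hfin' : volume (closedBall x (2 * s) \ E) < ∞ :=
      (measure_mono sdiff_subset).trans_lt measure_closedBall_lt_top
    have := setIntegral_mono_on (integrable_linePoisson hw).integrableOn
      (integrableOn_const (C := s⁻¹) hfin'.ne) (measurableSet_closedBall.diff hE)
      (fun t _ => (linePoisson_le hw t).trans_eq (by rw [hw2]))
    rw [setIntegral_const, smul_eq_mul, mul_comm (volume.real _)] at this
    exact this
  have h9 : s⁻¹ * volume.real (closedBall x (2 * s) \ E) ≤ δ / 2 := by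
    rw [inv_mul_le_iff₀ hs0]
    linarith
  have h10 := setIntegral_linePoisson_mono hw
    (inter_subset_right (s := closedBall x (2 * s)) (t := E)).eventuallyLE
  linarith

/-! ### Harmonic measure of sets on the real line -/

/-- The Cauchy integral of the set `E`. -/
def lineCauchy (E : Set ℝ) (w : ℂ) : ℂ := ∫ t in E, ((t : ℂ) - w)⁻¹

theorem differentiableAt_lineCauchy {E : Set ℝ} (hE : IsCompact E) {w : ℂ}
    (hw : w ∉ ((↑) : ℝ → ℂ) '' E) : DifferentiableAt ℂ (lineCauchy E) w := by
  have hc : IsCompact (((↑) : ℝ → ℂ) '' E) := hE.image Complex.continuous_ofReal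
  have := differentiableAt_cauchy (ν := volume.restrict E) (p := fun t : ℝ => (t : ℂ))
    (g := fun _ => 1) hc.isClosed Complex.continuous_ofReal.aestronglyMeasurable
    (by filter_upwards [ae_restrict_mem hE.measurableSet] with t ht using mem_image_of_mem _ ht)
    (integrableOn_const hE.measure_lt_top.ne) hw
  simp only [one_mul] at this
  exact this

theorem lineCauchy_im {E : Set ℝ} (hE : IsCompact E) {w : ℂ} (hw : w ∉ ((↑) : ℝ → ℂ) '' E) :
    (lineCauchy E w).im = ∫ t in E, w.im / ‖(t : ℂ) - w‖ ^ 2 := by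
  have hint : IntegrableOn (fun t : ℝ => ((t : ℂ) - w)⁻¹) E := by
    refine ContinuousOn.integrableOn_compact hE (ContinuousOn.inv₀ (by fun_prop) fun t ht => ?_)
    exact sub_ne_zero.2 fun h => hw (h ▸ mem_image_of_mem _ ht)
  have := Complex.imCLM.integral_comp_comm hint
  simp only [Complex.imCLM_apply] at this
  rw [lineCauchy, ← this]
  refine integral_congr_ae (Eventually.of_forall fun t => ?_)
  simp [Complex.inv_im, Complex.normSq_eq_norm_sq]

theorem abs_eq_one_of_sq {σ : ℝ} (hσ : σ ^ 2 = 1) : |σ| = 1 := by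
  rw [← sq_eq_sq₀ (abs_nonneg σ) zero_le_one, sq_abs, hσ, one_pow]

theorem lineCauchy_im_of_pos {E : Set ℝ} (hE : IsCompact E) {w : ℂ} {σ : ℝ} (hσ : σ ^ 2 = 1)
    (hw : 0 < σ * w.im) : σ * (lineCauchy E w).im = ∫ t in E, linePoisson w t := by
  have hw' : w ∉ ((↑) : ℝ → ℂ) '' E := by
    rintro ⟨t, -, rfl⟩
    simp at hw
  have habs : σ * w.im = |w.im| := by
    rw [← abs_of_pos hw, abs_mul, abs_eq_one_of_sq hσ, one_mul]
  rw [lineCauchy_im hE hw', ← integral_const_mul]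
  refine integral_congr_ae (Eventually.of_forall fun t => ?_)
  simp only [linePoisson, ← habs]
  ring

theorem lineCauchy_im_of_zero {E : Set ℝ} (hE : IsCompact E) {w : ℂ}
    (hw : w ∉ ((↑) : ℝ → ℂ) '' E) (h0 : w.im = 0) : (lineCauchy E w).im = 0 := by
  rw [lineCauchy_im hE hw]
  simp [h0]

/-- An exponential of the Cauchy integral of `E`, translated by `η` across the line. -/
def lineExp (E : Set ℝ) (σ : ℝ) (N : ℕ) (η : ℝ) (w : ℂ) : ℂ :=
  Complex.exp (N * (-Complex.I * σ * 2 * lineCauchy E (w + Complex.I * (σ * η)) - Real.pi))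

/-- On side `σ` the exponent is `N (2P - π)` with `P` the Poisson integral of `E` at the translated
point: large `N` detects where `P` exceeds `π/2`. -/
theorem norm_lineExp (E : Set ℝ) (σ : ℝ) (N : ℕ) (η : ℝ) (w : ℂ) :
    ‖lineExp E σ N η w‖ =
      Real.exp (N * (2 * (σ * (lineCauchy E (w + Complex.I * (σ * η))).im) - Real.pi)) := by
  rw [lineExp, Complex.norm_exp]
  congr 1
  simp only [Complex.sub_re, Complex.mul_re, Complex.mul_im, Complex.natCast_re,
    Complex.natCast_im, Complex.neg_re, Complex.neg_im, Complex.I_re, Complex.I_im,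
    Complex.ofReal_re, Complex.ofReal_im, Complex.re_ofNat, Complex.im_ofNat]
  ring

section

variable {K : Set ℂ} {c r : ℕ → ℝ} {σ : ℝ} {E : Set ℝ}

/-- Both cases are Thales' theorem: `E` lies within the diameter of the unit circle and avoids the
open diameter of every bead. -/
theorem IsBeads.setIntegral_linePoisson_frontier_le (h : IsBeads K c r)
    (hE : ∀ x ∈ E, (x : ℂ) ∈ K) {ζ : ℂ} (hζ : ζ ∈ frontier (sidePart K σ)) (h0 : ζ.im ≠ 0) :
    ∫ t in E, linePoisson ζ t ≤ Real.pi / 2 := by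
  rcases h.frontier_sidePart hζ h0 with h1 | ⟨n, hn⟩
  · refine setIntegral_linePoisson_le_of_subset h0 (c := 0) (ρ := 1) (by simpa using h1) ?_
    intro x hx
    have := (h.mem_iff.1 (hE x hx)).1
    rw [Complex.norm_real, Real.norm_eq_abs, abs_le] at this
    simpa using this
  · refine setIntegral_linePoisson_le_of_disjoint h0 hn ?_
    refine Set.disjoint_left.2 fun x hx hx' => ?_
    have := (h.mem_iff.1 (hE x hx)).2 n
    rw [← Complex.ofReal_sub, Complex.norm_real, Real.norm_eq_abs] at this
    have h2 : |x - c n| < r n := abs_lt.2 ⟨by linarith [hx'.1], by linarith [hx'.2]⟩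
    linarith

theorem im_add_shift (hσ : σ ^ 2 = 1) (z : ℂ) (η : ℝ) :
    σ * (z + Complex.I * (σ * η)).im = σ * z.im + η := by
  simp
  linear_combination η * hσ

/-- If a compact set on the line is null for the harmonic measure, then its Poisson integral is at
most one half inside. -/
theorem IsBeads.setIntegral_linePoisson_le (h : IsBeads K c r) (hσ : σ ^ 2 = 1) {a : ℂ}
    (ha : a ∈ sidePart K σ) {μ : Measure ℂ} (hμ : IsHarmonicMeasure (sidePart K σ) a μ)
    (hEc : IsCompact E) (hE : ∀ x ∈ E, (x : ℂ) ∈ K) (hμE : μ (((↑) : ℝ → ℂ) '' E) = 0) {z : ℂ}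
    (hz : z ∈ sidePart K σ) : ∫ t in E, linePoisson z t ≤ Real.pi / 2 := by
  have hprob := hμ.isProbabilityMeasure
  obtain ⟨ρ, hρ, M, hM, -, hbd⟩ := hμ.exists_norm_le (isOpen_sidePart K σ)
    (h.isBounded_sidePart σ) (h.isPreconnected_sidePart hσ) ha hz
  have hzE : ∀ w : ℂ, 0 < σ * w.im → w ∉ ((↑) : ℝ → ℂ) '' E := by
    rintro w hw ⟨t, -, rfl⟩
    simp at hw
  -- Translating by `η` away from the line moves the closed side off `E`, which gives continuity up
  -- to the boundary.
  have hdiff : ∀ (N : ℕ) (η : ℝ), 0 < η → DiffContOnCl ℂ (lineExp E σ N η) (sidePart K σ) := by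
    intro N η hη
    refine DifferentiableOn.diffContOnCl fun w hw => DifferentiableAt.differentiableWithinAt ?_
    have h1 : DifferentiableAt ℂ (lineCauchy E) (w + Complex.I * (σ * η)) := by
      refine differentiableAt_lineCauchy hEc (hzE _ ?_)
      rw [im_add_shift hσ]
      linarith [closure_sidePart_le hw]
    have h2 : DifferentiableAt ℂ (fun w => lineCauchy E (w + Complex.I * (σ * η))) w :=
      DifferentiableAt.comp (g := lineCauchy E) w h1 (by fun_prop)
    unfold lineExp
    fun_prop
  have htend : ∀ (N : ℕ) (w : ℂ), w ∉ ((↑) : ℝ → ℂ) '' E →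
      Tendsto (fun n : ℕ => ‖lineExp E σ N (1 / ((n : ℝ) + 1)) w‖) atTop
        (𝓝 (Real.exp (N * (2 * (σ * (lineCauchy E w).im) - Real.pi)))) := by
    intro N w hw
    simp_rw [norm_lineExp]
    have h1 : ContinuousAt (lineCauchy E) w := (differentiableAt_lineCauchy hEc hw).continuousAt
    have h2 : Tendsto (fun n : ℕ => w + Complex.I * (σ * ((1 / ((n : ℝ) + 1) : ℝ) : ℂ))) atTop
        (𝓝 w) := by
      have h3 := (Complex.continuous_ofReal.tendsto _).comp
        (tendsto_one_div_add_atTop_nhds_zero_nat (𝕜 := ℝ))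
      have h4 : Continuous fun s : ℂ => w + Complex.I * (σ * s) := by fun_prop
      have h5 := (h4.tendsto _).comp h3
      simpa [Function.comp_def] using h5
    have h6 := (Complex.continuous_im.tendsto _).comp (h1.tendsto.comp h2)
    have h7 : Continuous fun s : ℝ => Real.exp (N * (2 * (σ * s) - Real.pi)) := by fun_prop
    exact (h7.tendsto _).comp h6
  have hexp : ∀ N : ℕ, Real.exp (N * (2 * (∫ t in E, linePoisson z t) - Real.pi)) ≤ M := by
    intro N
    have hL := htend N z (hzE z hz.2)
    rw [lineCauchy_im_of_pos hEc hσ hz.2] at hL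
    have hae : ∀ᵐ ζ ∂μ, ζ ∉ ((↑) : ℝ → ℂ) '' E := measure_eq_zero_iff_ae_notMem.1 hμE
    -- The pointwise limit as `η → 0` exists off the null set `E`. The dominating constant comes
    -- from `2P - π ≤ π`.
    have hR : Tendsto (fun n : ℕ => ∫ ζ, ‖lineExp E σ N (1 / ((n : ℝ) + 1)) ζ‖ ∂μ) atTop
        (𝓝 (∫ ζ, Real.exp (N * (2 * (σ * (lineCauchy E ζ).im) - Real.pi)) ∂μ)) := by
      refine tendsto_integral_of_dominated_convergence (fun _ => Real.exp (N * Real.pi)) ?_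
        (integrable_const _) ?_ ?_
      · intro n
        exact (hμ.integrable (h.isBounded_sidePart σ)
          (hdiff N _ (by positivity)).continuousOn).norm.aestronglyMeasurable
      · intro n
        filter_upwards [hμ.ae_mem_frontier] with ζ hζ
        rw [norm_norm, norm_lineExp, Real.exp_le_exp]
        have hpos : 0 < σ * (ζ + Complex.I * (σ * ((1 / ((n : ℝ) + 1) : ℝ) : ℂ))).im := by
          rw [im_add_shift hσ]
          have : 0 < 1 / ((n : ℝ) + 1) := by positivity
          linarith [closure_sidePart_le hζ.1]
        rw [lineCauchy_im_of_pos hEc hσ hpos]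
        have h0 : (ζ + Complex.I * (σ * ((1 / ((n : ℝ) + 1) : ℝ) : ℂ))).im ≠ 0 := by
          intro h0
          rw [h0, mul_zero] at hpos
          exact hpos.false
        have := setIntegral_linePoisson_le_pi h0 E
        gcongr
        linarith
      · filter_upwards [hae] with ζ hζ using htend N ζ hζ
    have hle := le_of_tendsto_of_tendsto' hL (hR.const_mul M)
      (fun n => hbd z (mem_ball_self hρ) _ (hdiff N _ (by positivity)))
    refine hle.trans (mul_le_of_le_one_right hM.le ?_)
    have : ∫ ζ, Real.exp (N * (2 * (σ * (lineCauchy E ζ).im) - Real.pi)) ∂μ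
        ≤ ∫ _, (1 : ℝ) ∂μ := by
      refine integral_mono_of_nonneg (Eventually.of_forall fun _ => (Real.exp_pos _).le)
        (integrable_const _) ?_
      filter_upwards [hae, hμ.ae_mem_frontier] with ζ hζ hζf
      rw [Real.exp_le_one_iff]
      refine mul_nonpos_of_nonneg_of_nonpos (Nat.cast_nonneg N) ?_
      by_cases h0 : ζ.im = 0
      · rw [lineCauchy_im_of_zero hEc hζ h0]
        linarith [Real.pi_pos]
      · have hpos : 0 < σ * ζ.im := by
          refine lt_of_le_of_ne (closure_sidePart_le hζf.1) (Ne.symm (mul_ne_zero ?_ h0))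
          rintro rfl
          simp at hσ
        rw [lineCauchy_im_of_pos hEc hσ hpos]
        linarith [h.setIntegral_linePoisson_frontier_le hE hζf h0]
    simpa using this
  -- As `M` does not depend on `N`, a positive exponent would grow past it.
  by_contra! hlt
  have h1 : 0 < 2 * (∫ t in E, linePoisson z t) - Real.pi := by linarith
  obtain ⟨N, hN⟩ := exists_nat_gt (M / (2 * (∫ t in E, linePoisson z t) - Real.pi))
  rw [div_lt_iff₀ h1] at hN
  have := Real.add_one_le_exp (N * (2 * (∫ t in E, linePoisson z t) - Real.pi))
  linarith [hexp N]

/-- Length on the real line is absolutely continuous with respect to harmonic measure on the real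
points of `K`. -/
theorem IsBeads.volume_eq_zero (h : IsBeads K c r) (hσ : σ ^ 2 = 1) {a : ℂ}
    (ha : a ∈ sidePart K σ) {μ : Measure ℂ} (hμ : IsHarmonicMeasure (sidePart K σ) a μ)
    {B : Set ℝ} (hBm : MeasurableSet B) (hB : ∀ x ∈ B, (x : ℂ) ∈ K)
    (hμB : μ (((↑) : ℝ → ℂ) '' B) = 0) : volume B = 0 := by
  by_contra hne
  obtain ⟨E, hEB, hEc, hE0⟩ := hBm.exists_lt_isCompact (pos_iff_ne_zero.2 hne)
  have hEK : ∀ x ∈ E, (x : ℂ) ∈ K := fun x hx => hB x (hEB hx)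
  -- Just above or below a density point of `E` the Poisson integral exceeds `π/2`, and such points
  -- lie in the side; so `E` has almost no points.
  have hae : ∀ᵐ x : ℝ ∂volume.restrict E, False := by
    filter_upwards [Besicovitch.ae_tendsto_measure_inter_div volume E,
      ae_restrict_of_ae h.ae_cone_subset, ae_restrict_mem hEc.measurableSet] with x hx1 hx2 hxE
    obtain ⟨δ, hδ, hcone⟩ := hx2 (hEK x hxE)
    obtain ⟨s, hs1, hs2, hs3⟩ := ((eventually_lt_setIntegral_linePoisson hEc.measurableSet hx1).and
      ((eventually_nhdsWithin_of_eventually_nhds (eventually_lt_nhds hδ)).and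
        self_mem_nhdsWithin)).exists
    have hs3 : 0 < s := hs3
    set z : ℂ := ⟨x, σ * s⟩ with hz
    have hσ1 := abs_eq_one_of_sq hσ
    have hzim : |z.im| = s := by simp [hz, abs_mul, hσ1, abs_of_pos hs3]
    have hzG : z ∈ sidePart K σ := by
      refine ⟨hcone z (abs_pos.1 (hzim ▸ hs3)) ?_ (hzim ▸ hs2), ?_⟩
      · simp only [hz, sub_self, abs_zero]
        positivity
      · simp only [hz]
        nlinarith
    have h1 := hs1 z rfl hzim
    have h2 := h.setIntegral_linePoisson_le hσ ha hμ hEc hEK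
      (measure_mono_null (image_mono hEB) hμB) hzG
    linarith
  have : volume.restrict E = 0 := by
    rw [← ae_eq_bot]
    exact Filter.eventually_false_iff_eq_bot.1 hae
  rw [Measure.restrict_eq_zero] at this
  exact hE0.ne' this

end

/-! ### Approximation by rational functions -/

section Approximation

variable {K : Set ℂ} {ω μ : Measure ℂ}

theorem exists_eLpNorm_sub_lt {f : Lp ℂ 2 ω} (hf : f ∈ rationalLp K 2 ω) {ε : ℝ≥0∞} (hε : 0 < ε) :
    ∃ q ∈ ratFunctions K, eLpNorm (fun w => f w - q w) 2 ω < ε := by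
  obtain ⟨g, ⟨q, hq, hgq⟩, hlt⟩ := EMetric.mem_closure_iff.1 hf ε hε
  refine ⟨q, hq, ?_⟩
  rw [Lp.edist_def] at hlt
  refine (eLpNorm_congr_ae ?_).trans_lt hlt
  filter_upwards [hgq] with w hw
  simp [hw]

/-- Nontriviality of this filter makes limits along it unique, as `evalMap` requires. -/
theorem neBot_comap {f : Lp ℂ 2 ω} (hf : f ∈ rationalLp K 2 ω) :
    (comap (fun q : ratFunctions K => eLpNorm (fun w => f w - q.1 w) 2 ω) (𝓝 0)).NeBot := by
  rw [comap_neBot_iff]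
  intro t ht
  obtain ⟨ε, hε, hεt⟩ := (ENNReal.nhds_zero_basis.mem_iff).1 ht
  obtain ⟨q, hq, hlt⟩ := exists_eLpNorm_sub_lt hf hε
  exact ⟨⟨q, hq⟩, hεt hlt⟩

/-- For a probability measure `μ ≤ ω`, the `L¹(μ)` norm is at most the `L²(ω)` norm, and a bounded
multiplier preserves the convergence. -/
theorem tendsto_integral_mul [IsProbabilityMeasure μ] (hle : μ ≤ ω) {ι : Type*} {l : Filter ι}
    {f : ℂ → ℂ} (hf : MemLp f 2 ω) {Q : ι → ℂ → ℂ} (hQ : ∀ i, MemLp (Q i) 2 ω)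
    (ht : Tendsto (fun i => eLpNorm (fun w => f w - Q i w) 2 ω) l (𝓝 0)) {g : ℂ → ℂ}
    (hg : AEStronglyMeasurable g μ) {C : ℝ} (hgC : ∀ᵐ ζ ∂μ, ‖g ζ‖ ≤ C) :
    Tendsto (fun i => ∫ ζ, Q i ζ * g ζ ∂μ) l (𝓝 (∫ ζ, f ζ * g ζ ∂μ)) := by
  have hint : ∀ {u : ℂ → ℂ}, MemLp u 2 ω → Integrable u μ := fun hu =>
    (hu.mono_measure hle).integrable one_le_two
  have h0 : Tendsto (fun i => C * (eLpNorm (fun w => f w - Q i w) 2 ω).toReal) l (𝓝 0) := by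
    have := ((ENNReal.tendsto_toReal ENNReal.zero_ne_top).comp ht).const_mul C
    simpa using this
  rw [tendsto_iff_norm_sub_tendsto_zero]
  refine squeeze_zero (fun _ => norm_nonneg _) (fun i => ?_) h0
  have hsub : MemLp (fun w => f w - Q i w) 2 ω := hf.sub (hQ i)
  rw [norm_sub_rev, ← integral_sub ((hint hf).mul_bdd hg hgC) ((hint (hQ i)).mul_bdd hg hgC)]
  have hC0 : 0 ≤ C := by
    obtain ⟨ζ, hζ⟩ := hgC.exists
    exact (norm_nonneg _).trans hζ
  calc ‖∫ ζ, (f ζ * g ζ - Q i ζ * g ζ) ∂μ‖ ≤ ∫ ζ, C * ‖f ζ - Q i ζ‖ ∂μ := by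
        refine norm_integral_le_of_norm_le ((hint hsub).norm.const_mul C) ?_
        filter_upwards [hgC] with ζ hζ
        rw [← sub_mul, norm_mul, mul_comm]
        gcongr
    _ ≤ C * (eLpNorm (fun w => f w - Q i w) 2 ω).toReal := by
        rw [integral_const_mul]
        exact mul_le_mul_of_nonneg_left (integral_norm_le_eLpNorm hle hsub) hC0

/-- A representing measure takes only the values `0` and `1` on sets whose characteristic function
is approximable. -/
theorem measure_eq_zero_or_one [IsFiniteMeasure ω] (hK : IsCompact K) (hω : ∀ᵐ z ∂ω, z ∈ K)
    (hle : μ ≤ ω) {G : Set ℂ} {a : ℂ} (hG : IsOpen G) (hb : Bornology.IsBounded G)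
    (hGK : closure G ⊆ K) (hμ : IsHarmonicMeasure G a μ) {A : Set ℂ} (hA : MeasurableSet A)
    {f : Lp ℂ 2 ω} (hf : f ∈ rationalLp K 2 ω) (hfA : f =ᵐ[ω] A.indicator fun _ => (1 : ℂ)) :
    μ A = 0 ∨ μ Aᶜ = 0 := by
  have hprob := hμ.isProbabilityMeasure
  set l := comap (fun q : ratFunctions K => eLpNorm (fun w => f w - q.1 w) 2 ω) (𝓝 0)
  have hne : l.NeBot := neBot_comap hf
  have hlim : Tendsto (fun q : ratFunctions K => eLpNorm (fun w => f w - q.1 w) 2 ω) l (𝓝 0) :=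
    tendsto_comap
  have hfL : MemLp f 2 ω := Lp.memLp f
  have hQ : ∀ q : ratFunctions K, MemLp q.1 2 ω := fun q => memLp_of_mem_ratFunctions hK q.2 hω 2
  have hD : ∀ q : ratFunctions K, DiffContOnCl ℂ q.1 G := fun q =>
    diffContOnCl_of_mem_ratFunctions hGK q.2
  have hfAμ : f =ᵐ[μ] A.indicator fun _ => (1 : ℂ) := ae_mono hle hfA
  have hind : ∫ ζ, A.indicator (fun _ => (1 : ℂ)) ζ ∂μ = (μ.real A : ℂ) := by
    rw [integral_indicator hA, setIntegral_const]
    simp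
  have hf1 : ∫ ζ, f ζ * 1 ∂μ = (μ.real A : ℂ) := by
    rw [← hind]
    refine integral_congr_ae ?_
    filter_upwards [hfAμ] with ζ hζ
    rw [mul_one, hζ]
  have hf2 : ∫ ζ, f ζ * f ζ ∂μ = (μ.real A : ℂ) := by
    rw [← hind]
    refine integral_congr_ae ?_
    filter_upwards [hfAμ] with ζ hζ
    rw [hζ]
    by_cases h : ζ ∈ A <;> simp [h]
  have hval : ∀ q : ratFunctions K, ∫ ζ, q.1 ζ * 1 ∂μ = q.1 a := fun q => by
    simpa using hμ.integral_analytic hG hb (hD q)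
  have t1 : Tendsto (fun q : ratFunctions K => q.1 a) l (𝓝 (μ.real A : ℂ)) := by
    have := tendsto_integral_mul hle hfL hQ hlim (g := fun _ => 1)
      aestronglyMeasurable_const (C := 1) (by simp)
    rw [hf1] at this
    exact this.congr hval
  -- Multipliers must be bounded, so the product `f * f` is reached one factor at a time: here one
  -- factor is still rational, and in `t3` it is replaced by its limit.
  have t2 : ∀ k : ratFunctions K, ∫ ζ, k.1 ζ * f ζ ∂μ = k.1 a * μ.real A := by
    intro k
    obtain ⟨C, hC⟩ := exists_bound_of_mem_ratFunctions hK k.2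
    have h1 := tendsto_integral_mul hle hfL hQ hlim (g := k.1)
      (measurable_of_mem_ratFunctions k.2).aestronglyMeasurable
      ((show ∀ᵐ z ∂μ, z ∈ K from ae_mono hle hω).mono fun ζ hζ => hC ζ hζ)
    have h2 : Tendsto (fun q : ratFunctions K => ∫ ζ, q.1 ζ * k.1 ζ ∂μ) l
        (𝓝 (k.1 a * μ.real A)) := by
      refine (t1.const_mul (k.1 a)).congr fun q => ?_
      have h3 : DiffContOnCl ℂ (fun ζ => q.1 ζ * k.1 ζ) G := (hD q).smul (hD k)
      rw [hμ.integral_analytic hG hb h3, mul_comm]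
    rw [← tendsto_nhds_unique h1 h2]
    simp_rw [mul_comm]
  have t3 : (μ.real A : ℂ) = μ.real A * μ.real A := by
    have h1 := tendsto_integral_mul hle hfL hQ hlim (g := f)
      ((hfL.mono_measure hle).aestronglyMeasurable) (C := 1) (by
        filter_upwards [hfAμ] with ζ hζ
        rw [hζ]
        by_cases h : ζ ∈ A <;> simp [h])
    rw [hf2] at h1
    simp_rw [t2] at h1
    exact tendsto_nhds_unique h1 (t1.mul_const _)
  have t4 : μ.real A = μ.real A * μ.real A := by exact_mod_cast t3
  rcases eq_or_ne (μ.real A) 0 with h | h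
  · left
    rwa [measureReal_eq_zero_iff] at h
  · right
    have h1 : μ.real A = 1 := by
      have := mul_right_cancel₀ h ((one_mul _).trans t4)
      exact this.symm
    rw [prob_compl_eq_zero_iff hA]
    rw [measureReal_def, ENNReal.toReal_eq_one_iff] at h1
    exact h1

end Approximation

/-! ### Point evaluations as integrals -/

/-- `ζ - a` times the difference of the Cauchy kernels at a point and at its conjugate. -/
def reflectedKernel (a z ζ : ℂ) : ℂ := (ζ - a) * ((ζ - z)⁻¹ - (ζ - (starRingEnd ℂ) z)⁻¹)

section Side

variable {K : Set ℂ} {c r : ℕ → ℝ} {σ : ℝ} {a z : ℂ} {μ ω : Measure ℂ}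

theorem conj_notMem_closure (hz : z ∈ sidePart K σ) :
    (starRingEnd ℂ) z ∉ closure (sidePart K σ) := by
  intro h
  have h1 := closure_sidePart_le h
  have h2 := hz.2
  rw [Complex.conj_im] at h1
  linarith

theorem notMem_frontier (hz : z ∈ sidePart K σ) : z ∉ frontier (sidePart K σ) := by
  rw [(isOpen_sidePart K σ).frontier_eq]
  exact fun h => h.2 hz

/-- The conjugate of `z` lies off the closure of the side, so its Cauchy integral vanishes and may
be subtracted. The resulting kernel decays quadratically. -/
theorem IsBeads.mul_cauchyWeight_eq (h : IsBeads K c r)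
    (hμ : IsHarmonicMeasure (sidePart K σ) a μ) (hz : z ∈ sidePart K σ) {q : ℂ → ℂ}
    (hq : DiffContOnCl ℂ q (sidePart K σ)) :
    q z * cauchyWeight μ a z = ∫ ζ, q ζ * reflectedKernel a z ζ ∂μ := by
  have hG := isOpen_sidePart K σ
  have hb := h.isBounded_sidePart σ
  have h1 := hμ.mul_cauchyWeight hG hb hq hz
  have h2 := hμ.cauchy_eq_zero hG hb hq (conj_notMem_closure hz)
  have h3 : ∀ ζ, q ζ * reflectedKernel a z ζ =
      q ζ * ((ζ - a) * (ζ - z)⁻¹) - q ζ * ((ζ - a) * (ζ - (starRingEnd ℂ) z)⁻¹) := fun ζ => by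
    rw [reflectedKernel]; ring
  simp_rw [h3]
  rw [integral_sub (hμ.integrable_mul_inv hb hq.continuousOn (notMem_frontier hz))
    (hμ.integrable_mul_inv hb hq.continuousOn
      fun hf => conj_notMem_closure hz (frontier_subset_closure hf)), h2, sub_zero, h1]

theorem IsBeads.cauchyWeight_eq (h : IsBeads K c r)
    (hμ : IsHarmonicMeasure (sidePart K σ) a μ) (hz : z ∈ sidePart K σ) :
    cauchyWeight μ a z = ∫ ζ, reflectedKernel a z ζ ∂μ := by
  simpa using h.mul_cauchyWeight_eq hμ hz (q := fun _ => 1) diffContOnCl_const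

theorem measurable_reflectedKernel (a z : ℂ) : Measurable (reflectedKernel a z) := by
  unfold reflectedKernel
  fun_prop

theorem IsBeads.exists_reflectedKernel_le (h : IsBeads K c r) (hz : z ∈ sidePart K σ) :
    ∃ C, ∀ ζ ∈ frontier (sidePart K σ), ‖reflectedKernel a z ζ‖ ≤ C := by
  have hK : IsCompact (frontier (sidePart K σ)) :=
    (h.isBounded_sidePart σ).isCompact_closure.of_isClosed_subset isClosed_frontier
      frontier_subset_closure
  refine hK.exists_bound_of_continuousOn (ContinuousOn.mul (by fun_prop) (ContinuousOn.sub ?_ ?_))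
  · exact continuousOn_inv_sub (notMem_frontier hz)
  · exact continuousOn_inv_sub
      fun hf => conj_notMem_closure hz (frontier_subset_closure hf)

/-- The reproducing formula for rational functions has a bounded kernel, so it passes to the limit.
-/
theorem IsBeads.evalMap_eq [IsFiniteMeasure ω] (h : IsBeads K c r) (hω : ∀ᵐ z ∂ω, z ∈ K)
    (hle : μ ≤ ω) (hμ : IsHarmonicMeasure (sidePart K σ) a μ) (hz : z ∈ sidePart K σ)
    (hw : cauchyWeight μ a z ≠ 0) {f : Lp ℂ 2 ω} (hf : f ∈ rationalLp K 2 ω) :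
    evalMap K 2 ω f z = (∫ ζ, f ζ * reflectedKernel a z ζ ∂μ) / cauchyWeight μ a z := by
  have hprob := hμ.isProbabilityMeasure
  have hne := neBot_comap hf
  obtain ⟨C, hC⟩ := h.exists_reflectedKernel_le (a := a) hz
  refine Tendsto.limUnder_eq ?_
  have h1 := (tendsto_integral_mul hle (Lp.memLp f)
    (fun q : ratFunctions K => memLp_of_mem_ratFunctions h.isCompact q.2 hω 2) tendsto_comap
    (measurable_reflectedKernel a z).aestronglyMeasurable
    (hμ.ae_mem_frontier.mono hC)).div_const (cauchyWeight μ a z)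
  refine h1.congr fun q => ?_
  rw [← h.mul_cauchyWeight_eq hμ hz
    (diffContOnCl_of_mem_ratFunctions (h.closure_sidePart_subset σ) q.2), mul_div_cancel_right₀ _ hw]

theorem IsBeads.sidePart_subset_abpe [IsFiniteMeasure ω] (h : IsBeads K c r) (hσ : σ ^ 2 = 1)
    (hω : ∀ᵐ z ∂ω, z ∈ K) (hle : μ ≤ ω) (ha : a ∈ sidePart K σ)
    (hμ : IsHarmonicMeasure (sidePart K σ) a μ) : sidePart K σ ⊆ abpe K 2 ω := by
  have hprob := hμ.isProbabilityMeasure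
  have key : ∀ z₀ ∈ sidePart K σ, ∃ ρ > 0, ∃ M > 0, ball z₀ ρ ⊆ sidePart K σ ∧
      ∀ z ∈ ball z₀ ρ, ∀ q ∈ ratFunctions K, ‖q z‖ ≤ M * (eLpNorm q 2 ω).toReal := by
    intro z₀ hz₀
    obtain ⟨ρ, hρ, M, hM, hsub, hbd⟩ := hμ.exists_norm_le (isOpen_sidePart K σ)
      (h.isBounded_sidePart σ) (h.isPreconnected_sidePart hσ) ha hz₀
    refine ⟨ρ, hρ, M, hM, hsub, fun z hz q hq => ?_⟩
    refine (hbd z hz q (diffContOnCl_of_mem_ratFunctions (h.closure_sidePart_subset σ) hq)).trans ?_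
    exact mul_le_mul_of_nonneg_left
      (integral_norm_le_eLpNorm hle (memLp_of_mem_ratFunctions h.isCompact hq hω 2)) hM.le
  have hbpe : sidePart K σ ⊆ bpe K 2 ω := by
    intro z hz
    obtain ⟨ρ, hρ, M, -, -, hbd⟩ := key z hz
    exact ⟨sidePart_subset hz, M, hbd z (mem_ball_self hρ)⟩
  intro z₀ hz₀
  obtain ⟨ρ, hρ, M, hM, -, hbd⟩ := key z₀ hz₀
  exact ⟨interior_maximal hbpe (isOpen_sidePart K σ) hz₀, ρ, hρ, M, hM, hbd⟩

end Side

/-! ### Averages against Poisson type kernels -/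

/-- A radial majorant of the Poisson kernel at height `y` above `x`. -/
def coneKernel (x : ℂ) (y : ℝ) (ζ : ℂ) : ℝ := y / (‖ζ - x‖ + y) ^ 2

theorem measurable_coneKernel (x : ℂ) (y : ℝ) : Measurable (coneKernel x y) := by
  unfold coneKernel
  fun_prop

/-- Dyadic decomposition: at distance about `2 ^ k * y` the kernel is at most about `4 ^ (-k) / y`.
-/
theorem coneKernel_le_tsum (x : ℂ) {y : ℝ} (hy : 0 < y) (ζ : ℂ) :
    ENNReal.ofReal (coneKernel x y ζ) ≤ ∑' k : ℕ, (closedBall x (2 ^ k * y)).indicator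
      (fun _ => ENNReal.ofReal (4 * (1 / 4) ^ k / y)) ζ := by
  set s := ‖ζ - x‖ with hs
  have hs0 : 0 ≤ s := norm_nonneg _
  obtain ⟨k, hk1, hk2⟩ := exists_nat_pow_near (le_max_left 1 (s / y)) one_lt_two
  -- The ball containing `ζ` is the one of index `k + 1`, while the kernel bound uses `k`; the
  -- factor `4` in the coefficients absorbs the shift.
  refine le_trans ?_ (ENNReal.le_tsum (k + 1))
  have hmem : ζ ∈ closedBall x (2 ^ (k + 1) * y) := by
    rw [mem_closedBall, dist_eq_norm]
    exact ((div_le_iff₀ hy).1 ((le_max_right 1 _).trans hk2.le))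
  rw [indicator_of_mem hmem]
  refine ENNReal.ofReal_le_ofReal ?_
  have hle : 2 ^ k * y ≤ s + y := by
    have h1 : max 1 (s / y) ≤ (s + y) / y := by
      refine max_le ?_ ?_
      · rw [le_div_iff₀ hy]; linarith
      · gcongr; linarith
    exact (le_div_iff₀ hy).1 (hk1.trans h1)
  have h2 : coneKernel x y ζ ≤ y / (2 ^ k * y) ^ 2 := by
    unfold coneKernel
    rw [← hs]
    gcongr
  refine h2.trans (le_of_eq ?_)
  have h4 : (4 : ℝ) ^ k = (2 ^ k) ^ 2 := by rw [← pow_mul, mul_comm, pow_mul]; norm_num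
  rw [one_div_pow, pow_succ (4 : ℝ), h4]
  field_simp

/-- The ball of index `k` contributes at most `4 ε 2 ^ (-k)`, and the geometric series gives `8 ε`.
-/
theorem lintegral_coneKernel_le {ν : Measure ℂ} {x : ℂ} {ε : ℝ≥0∞}
    (h : ∀ s : ℝ, 0 < s → ν (closedBall x s) ≤ ε * ENNReal.ofReal s) {y : ℝ} (hy : 0 < y) :
    ∫⁻ ζ, ENNReal.ofReal (coneKernel x y ζ) ∂ν ≤ 8 * ε := by
  calc ∫⁻ ζ, ENNReal.ofReal (coneKernel x y ζ) ∂ν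
      ≤ ∫⁻ ζ, ∑' k : ℕ, (closedBall x (2 ^ k * y)).indicator
          (fun _ => ENNReal.ofReal (4 * (1 / 4) ^ k / y)) ζ ∂ν :=
        lintegral_mono fun ζ => coneKernel_le_tsum x hy ζ
    _ = ∑' k : ℕ, ENNReal.ofReal (4 * (1 / 4) ^ k / y) * ν (closedBall x (2 ^ k * y)) := by
        rw [lintegral_tsum fun k =>
          (measurable_const.indicator measurableSet_closedBall).aemeasurable]
        congr 1 with k
        rw [lintegral_indicator_const measurableSet_closedBall]
    _ ≤ ∑' k : ℕ, ENNReal.ofReal (4 * (1 / 2) ^ k) * ε := by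
        refine ENNReal.tsum_le_tsum fun k => ?_
        refine (mul_le_mul_right (h _ (by positivity)) _).trans (le_of_eq ?_)
        rw [mul_comm ε, ← mul_assoc, ← ENNReal.ofReal_mul (by positivity)]
        congr 2
        have h4 : (4 : ℝ) ^ k = (2 ^ k) ^ 2 := by rw [← pow_mul, mul_comm, pow_mul]; norm_num
        rw [one_div_pow, one_div_pow, h4]
        field_simp
    _ = 8 * ε := by
        rw [ENNReal.tsum_mul_right, ← ENNReal.ofReal_tsum_of_nonneg (fun k => by positivity)
          (summable_geometric_two.mul_left 4), tsum_mul_left, tsum_geometric_two]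
        norm_num

theorem tendsto_lintegral_coneKernel {ν : Measure ℂ} [IsFiniteMeasure ν] {x : ℂ}
    (h : Tendsto (fun s => ν (closedBall x s) / ENNReal.ofReal s) (𝓝[>] 0) (𝓝 0)) :
    Tendsto (fun y => ∫⁻ ζ, ENNReal.ofReal (coneKernel x y ζ) ∂ν) (𝓝[>] 0) (𝓝 0) := by
  rw [ENNReal.tendsto_nhds_zero]
  intro ε hε
  have hε' : 0 < ε / 16 := ENNReal.div_pos hε.ne' (by norm_num)
  obtain ⟨R, hR, hsmall⟩ := mem_nhdsGT_iff_exists_Ioc_subset.1 (ENNReal.tendsto_nhds_zero.1 h _ hε')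
  have hR : 0 < R := hR
  -- Restricting `ν` to a small ball makes the growth bound valid at every scale. The rest of `ν`
  -- sees a kernel of size at most `y / R ^ 2`.
  have hA : ∀ s : ℝ, 0 < s → ν.restrict (closedBall x R) (closedBall x s)
      ≤ ε / 16 * ENNReal.ofReal s := by
    intro s hs
    have hball : ∀ t ∈ Ioc 0 R, ν (closedBall x t) ≤ ε / 16 * ENNReal.ofReal t := by
      intro t ht
      have h1 : ν (closedBall x t) / ENNReal.ofReal t ≤ ε / 16 := hsmall ht
      rwa [ENNReal.div_le_iff (by simpa using ht.1) ENNReal.ofReal_ne_top] at h1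
    rw [Measure.restrict_apply measurableSet_closedBall]
    rcases le_total s R with hsR | hsR
    · exact (measure_mono inter_subset_left).trans (hball s ⟨hs, hsR⟩)
    · refine (measure_mono inter_subset_right).trans ((hball R ⟨hR, le_rfl⟩).trans ?_)
      gcongr
  have hlim : Tendsto (fun y : ℝ => ENNReal.ofReal (y / R ^ 2) * ν univ) (𝓝[>] 0) (𝓝 0) := by
    have h1 : Tendsto (fun y : ℝ => ENNReal.ofReal (y / R ^ 2)) (𝓝[>] 0) (𝓝 0) := by
      have h2 : Continuous fun y : ℝ => ENNReal.ofReal (y / R ^ 2) :=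
      ENNReal.continuous_ofReal.comp (by fun_prop)
      have h3 := h2.tendsto 0
      simp only [zero_div, ENNReal.ofReal_zero] at h3
      exact h3.mono_left nhdsWithin_le_nhds
    simpa using ENNReal.Tendsto.mul_const h1 (Or.inr (measure_ne_top ν univ))
  filter_upwards [ENNReal.tendsto_nhds_zero.1 hlim (ε / 2) (ENNReal.half_pos hε.ne'),
    self_mem_nhdsWithin] with y hy1 hy2
  have hy2 : 0 < y := hy2
  rw [← lintegral_add_compl _ (measurableSet_closedBall (x := x) (ε := R))]
  have h1 : 8 * (ε / 16) = ε / 2 := by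
    rw [div_eq_mul_inv, div_eq_mul_inv, mul_left_comm]
    congr 1
    rw [show (16 : ℝ≥0∞) = 8 * 2 by norm_num, ENNReal.mul_inv (by norm_num) (by norm_num),
      ← mul_assoc, ENNReal.mul_inv_cancel (by norm_num) (by norm_num), one_mul]
  refine (add_le_add (lintegral_coneKernel_le hA hy2) ?_).trans
    ((add_le_add h1.le hy1).trans (ENNReal.add_halves ε).le)
  calc ∫⁻ ζ in (closedBall x R)ᶜ, ENNReal.ofReal (coneKernel x y ζ) ∂ν
      ≤ ∫⁻ _ in (closedBall x R)ᶜ, ENNReal.ofReal (y / R ^ 2) ∂ν := by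
        refine setLIntegral_mono measurable_const fun ζ hζ => ENNReal.ofReal_le_ofReal ?_
        have h3 : R < ‖ζ - x‖ := by simpa [dist_eq_norm] using hζ
        unfold coneKernel
        gcongr
        linarith
    _ ≤ ENNReal.ofReal (y / R ^ 2) * ν univ := by
        rw [setLIntegral_const]
        exact mul_le_mul_right (measure_mono (subset_univ _)) _

/-- Integrals dominated by a multiple of the kernel tend to zero at points where the density of the
measure vanishes. -/
theorem tendsto_integral_of_coneKernel {μ : Measure ℂ} {x : ℂ} {u : ℂ → ℂ}
    (hu : Integrable u μ)
    (h : Tendsto (fun s => (∫⁻ ζ in closedBall x s, ‖u ζ‖ₑ ∂μ) / ENNReal.ofReal s) (𝓝[>] 0) (𝓝 0))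
    {l : Filter ℂ} {Y : ℂ → ℝ} (hY : Tendsto Y l (𝓝[>] 0)) {g : ℂ → ℂ → ℂ} {C : ℝ}
    (hC : 0 ≤ C)
    (hg : ∀ᶠ z in l, ∀ᵐ ζ ∂μ, ‖g z ζ‖ ≤ C * (‖u ζ‖ * coneKernel x (Y z) ζ)) :
    Tendsto (fun z => ∫ ζ, g z ζ ∂μ) l (𝓝 0) := by
  -- Absorbing `|u|` into the measure reduces the claim to a kernel integral.
  set ν := μ.withDensity fun ζ => ‖u ζ‖ₑ with hν
  have : IsFiniteMeasure ν := isFiniteMeasure_withDensity hu.hasFiniteIntegral.ne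
  have h1 : Tendsto (fun s => ν (closedBall x s) / ENNReal.ofReal s) (𝓝[>] 0) (𝓝 0) := by
    refine h.congr fun s => ?_
    rw [hν, withDensity_apply _ measurableSet_closedBall]
  have h2 : Tendsto (fun z => ENNReal.ofReal C *
      ∫⁻ ζ, ENNReal.ofReal (coneKernel x (Y z) ζ) ∂ν) l (𝓝 0) := by
    have := ENNReal.Tendsto.const_mul ((tendsto_lintegral_coneKernel h1).comp hY)
      (a := ENNReal.ofReal C) (Or.inr ENNReal.ofReal_ne_top)
    simpa using this
  rw [tendsto_zero_iff_enorm_tendsto_zero]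
  refine tendsto_of_tendsto_of_tendsto_of_le_of_le' tendsto_const_nhds h2
    (Eventually.of_forall fun _ => zero_le) ?_
  filter_upwards [hg] with z hz
  refine (enorm_integral_le_lintegral_enorm _).trans ?_
  rw [hν, lintegral_withDensity_eq_lintegral_mul₀ hu.aestronglyMeasurable.enorm
    (measurable_coneKernel x (Y z)).ennreal_ofReal.aemeasurable, ← lintegral_const_mul']
  · refine lintegral_mono_ae ?_
    filter_upwards [hz] with ζ hζ
    rw [← ofReal_norm]
    refine (ENNReal.ofReal_le_ofReal hζ).trans ?_
    simp only [Pi.mul_apply]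
    rw [ENNReal.ofReal_mul hC, ENNReal.ofReal_mul (norm_nonneg _), ofReal_norm]
  · exact ENNReal.ofReal_ne_top

/-! ### Differentiation of harmonic measure on the real line -/

/-- The real line in the plane. -/
def realLine : Set ℂ := {z | z.im = 0}

theorem measurableSet_realLine : MeasurableSet realLine :=
  (isClosed_eq Complex.continuous_im continuous_const).measurableSet

theorem image_closedBall_ofReal (x s : ℝ) :
    ((↑) : ℝ → ℂ) '' closedBall x s = realLine ∩ closedBall (x : ℂ) s := by
  ext z
  constructor
  · rintro ⟨t, ht, rfl⟩
    refine ⟨by simp [realLine], ?_⟩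
    rwa [mem_closedBall, Complex.isometry_ofReal.dist_eq]
  · rintro ⟨hz, hz'⟩
    have h1 : ((z.re : ℝ) : ℂ) = z := Complex.ext (by simp) (by simpa [realLine] using hz.symm)
    refine ⟨z.re, ?_, h1⟩
    rwa [← h1, mem_closedBall, Complex.isometry_ofReal.dist_eq] at hz'

/-- Regularity of a measure at a real point: it is comparable to length there, and the part off
the line has density zero. -/
structure IsRegularAt (μ : Measure ℂ) (x : ℝ) : Prop where
  upper : ∃ C : ℝ≥0∞, C ≠ ∞ ∧
    ∀ᶠ s : ℝ in 𝓝[>] 0, μ (closedBall (x : ℂ) s) ≤ C * ENNReal.ofReal s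
  lower : ∃ D : ℝ, 0 < D ∧
    ∀ᶠ s : ℝ in 𝓝[>] 0, ENNReal.ofReal (D * s) ≤ μ (realLine ∩ closedBall (x : ℂ) s)
  off_line : Tendsto (fun s => μ (realLineᶜ ∩ closedBall (x : ℂ) s) / μ (closedBall (x : ℂ) s))
    (𝓝[>] 0) (𝓝 0)

theorem measurableEmbedding_ofReal : MeasurableEmbedding ((↑) : ℝ → ℂ) :=
  Complex.isometry_ofReal.isClosedEmbedding.measurableEmbedding

theorem ae_comap_ofReal {μ : Measure ℂ} {P : ℂ → Prop} (h : ∀ᵐ ζ ∂μ, P ζ) :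
    ∀ᵐ x : ℝ ∂μ.comap ((↑) : ℝ → ℂ), P x := by
  rw [ae_iff, measurableEmbedding_ofReal.comap_apply]
  refine measure_mono_null ?_ (ae_iff.1 h)
  rintro _ ⟨x, hx, rfl⟩
  exact hx

/-- At almost every point of `F` the derivative of `μ` on the line with respect to length is finite,
and positive by absolute continuity, while the line has full `μ`-density. -/
theorem ae_isRegularAt {μ : Measure ℂ} [IsFiniteMeasure μ] {F : Set ℝ}
    (hac : volume.restrict F ≪ μ.comap ((↑) : ℝ → ℂ)) :
    ∀ᵐ x ∂volume.restrict F, IsRegularAt μ x := by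
  set m := μ.comap ((↑) : ℝ → ℂ) with hm
  have : IsFiniteMeasure m := 
    ⟨by rw [hm, measurableEmbedding_ofReal.comap_apply]; exact measure_lt_top μ _⟩
  have hoff := hac.ae_le (ae_comap_ofReal
    (Besicovitch.ae_tendsto_measure_inter_div_of_measurableSet μ measurableSet_realLine.compl))
  have hon := hac.ae_le (ae_comap_ofReal
    (Besicovitch.ae_tendsto_measure_inter_div_of_measurableSet μ measurableSet_realLine))
  filter_upwards [hoff, hon, Besicovitch.ae_tendsto_rnDeriv m (volume.restrict F),
    Besicovitch.ae_tendsto_measure_inter_div volume F, Measure.rnDeriv_pos' hac,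
    Measure.rnDeriv_ne_top m (volume.restrict F)] with x h1 h2 h3 h4 h5 h6
  have hx : (x : ℂ) ∈ realLine := by simp [realLine]
  rw [indicator_of_notMem (by simpa using hx)] at h1
  rw [indicator_of_mem hx] at h2
  have h7 : Tendsto (fun s => μ (realLine ∩ closedBall (x : ℂ) s) / ENNReal.ofReal (2 * s)) (𝓝[>] 0)
      (𝓝 (m.rnDeriv (volume.restrict F) x)) := by
    -- Multiplying by the density of `F` replaces the length of `F ∩ closedBall x s` by `2 * s`.
    have := ENNReal.Tendsto.mul h3 (Or.inr ENNReal.one_ne_top) h4 (Or.inr h6)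
    rw [mul_one] at this
    refine this.congr' ?_
    have e1 : ∀ᶠ s in 𝓝[>] (0 : ℝ), 0 < volume (F ∩ closedBall x s) / volume (closedBall x s) :=
      h4.eventually_const_lt one_pos
    filter_upwards [e1] with s hs
    rw [Measure.restrict_apply measurableSet_closedBall, inter_comm (closedBall x s) F, hm,
      measurableEmbedding_ofReal.comap_apply, image_closedBall_ofReal, ← Real.volume_closedBall x s]
    have hne : volume (F ∩ closedBall x s) ≠ 0 := by
      intro h0
      simp [h0] at hs
    have hnt : volume (F ∩ closedBall x s) ≠ ∞ :=
      ne_top_of_le_ne_top measure_closedBall_lt_top.ne (measure_mono inter_subset_right)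
    rw [← mul_div_assoc, ENNReal.div_mul_cancel hne hnt]
  set D := m.rnDeriv (volume.restrict F) x with hD
  -- Eventually the line carries at least half of the mass of the ball, and at most `(D + 1) * (2 *
  -- s)`. For the lower bound, half of the density `D` over length `2 * s` leaves `D * s`.
  refine ⟨⟨2 * ((D + 1) * 2), ?_, ?_⟩, ⟨D.toReal, ENNReal.toReal_pos h5.ne' h6, ?_⟩, h1⟩
  · exact ENNReal.mul_ne_top (by simp) (ENNReal.mul_ne_top (by simp [h6]) (by simp))
  · have e1 := h7.eventually_lt_const (ENNReal.lt_add_right h6 one_ne_zero)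
    have e2 := h2.eventually_const_lt (show (2 : ℝ≥0∞)⁻¹ < (1 : ℂ → ℝ≥0∞) x by simp)
    filter_upwards [e1, e2, self_mem_nhdsWithin] with s hs1 hs2 hs3
    have hs3 : 0 < s := hs3
    have hs4 : μ (realLine ∩ closedBall (x : ℂ) s) ≤ (D + 1) * 2 * ENNReal.ofReal s := by
      rw [ENNReal.div_lt_iff (Or.inl (by simpa using hs3)) (Or.inl ENNReal.ofReal_ne_top),
        ENNReal.ofReal_mul zero_le_two, ← mul_assoc] at hs1
      simpa using hs1.le
    have hs5 : μ (closedBall (x : ℂ) s) ≤ 2 * μ (realLine ∩ closedBall (x : ℂ) s) := by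
      rcases eq_or_ne (μ (closedBall (x : ℂ) s)) 0 with h0 | h0
      · simp [h0]
      rw [ENNReal.lt_div_iff_mul_lt (Or.inl h0) (Or.inl (measure_ne_top _ _))] at hs2
      have := mul_le_mul_right hs2.le 2
      rwa [← mul_assoc, ENNReal.mul_inv_cancel (by norm_num) (by norm_num), one_mul] at this
    refine hs5.trans ?_
    rw [mul_assoc]
    exact mul_le_mul_right hs4 2
  · have hlt : D / 2 < D := ENNReal.half_lt_self h5.ne' h6
    filter_upwards [h7.eventually_const_lt hlt, self_mem_nhdsWithin] with s hs1 hs2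
    have hs2 : 0 < s := hs2
    rw [ENNReal.lt_div_iff_mul_lt (Or.inl (by simpa using hs2)) (Or.inl ENNReal.ofReal_ne_top),
      ENNReal.ofReal_mul zero_le_two, ← mul_assoc] at hs1
    rw [ENNReal.ofReal_mul ENNReal.toReal_nonneg, ENNReal.ofReal_toReal h6]
    refine le_trans (le_of_eq ?_) hs1.le
    rw [ENNReal.ofReal_ofNat, ENNReal.div_mul_cancel (by norm_num) (by norm_num)]

/-- The upper bound trades `μ(closedBall x s)` for `s`; the lower bound makes this mass nonzero, so
the division is genuine. -/
theorem IsRegularAt.tendsto_div {μ : Measure ℂ} [IsFiniteMeasure μ] {x : ℝ} (h : IsRegularAt μ x)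
    {A : ℝ → ℝ≥0∞}
    (hA : Tendsto (fun s => A s / μ (closedBall (x : ℂ) s)) (𝓝[>] 0) (𝓝 0)) :
    Tendsto (fun s => A s / ENNReal.ofReal s) (𝓝[>] 0) (𝓝 0) := by
  obtain ⟨C, hC, hup⟩ := h.upper
  obtain ⟨D, hD, hlow⟩ := h.lower
  have h1 := ENNReal.Tendsto.mul_const hA (b := C) (Or.inr hC)
  rw [zero_mul] at h1
  refine tendsto_of_tendsto_of_tendsto_of_le_of_le' tendsto_const_nhds h1
    (Eventually.of_forall fun _ => zero_le) ?_
  filter_upwards [hup, hlow, self_mem_nhdsWithin] with s hs1 hs2 hs3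
  have hs3 : 0 < s := hs3
  have hpos : μ (closedBall (x : ℂ) s) ≠ 0 := by
    refine (lt_of_lt_of_le ?_ (hs2.trans (measure_mono inter_subset_right))).ne'
    rw [ENNReal.ofReal_pos]; positivity
  rw [ENNReal.div_le_iff (by simpa using hs3) ENNReal.ofReal_ne_top, mul_assoc]
  refine le_trans (le_of_eq ?_) (mul_le_mul_right hs1 _)
  rw [ENNReal.div_mul_cancel hpos (measure_ne_top _ _)]

theorem IsRegularAt.tendsto_off_line {μ : Measure ℂ} [IsFiniteMeasure μ] {x : ℝ}
    (h : IsRegularAt μ x) :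
    Tendsto (fun s => (∫⁻ ζ in closedBall (x : ℂ) s, ‖realLineᶜ.indicator (fun _ => (1 : ℂ)) ζ‖ₑ ∂μ)
      / ENNReal.ofReal s) (𝓝[>] 0) (𝓝 0) := by
  refine (h.tendsto_div h.off_line).congr fun s => ?_
  congr 1
  have : ∀ ζ, ‖realLineᶜ.indicator (fun _ => (1 : ℂ)) ζ‖ₑ
      = realLineᶜ.indicator (fun _ => (1 : ℝ≥0∞)) ζ := fun ζ => by
    rw [enorm_indicator_eq_indicator_enorm]
    simp
  simp_rw [this]
  rw [lintegral_indicator_const measurableSet_realLine.compl, one_mul,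
    Measure.restrict_apply measurableSet_realLine.compl]

theorem IsRegularAt.tendsto_sub {μ : Measure ℂ} [IsFiniteMeasure μ] {x : ℝ}
    (h : IsRegularAt μ x) :
    Tendsto (fun s => (∫⁻ ζ in closedBall (x : ℂ) s, ‖ζ - x‖ₑ ∂μ)
      / ENNReal.ofReal s) (𝓝[>] 0) (𝓝 0) := by
  obtain ⟨C, hC, hup⟩ := h.upper
  have h1 : Tendsto (fun s : ℝ => C * ENNReal.ofReal s) (𝓝[>] 0) (𝓝 0) := by
    have h2 := (ENNReal.continuous_ofReal.tendsto 0).mono_left (nhdsWithin_le_nhds (s := Ioi 0))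
    rw [ENNReal.ofReal_zero] at h2
    simpa using ENNReal.Tendsto.const_mul h2 (a := C) (Or.inr hC)
  refine tendsto_of_tendsto_of_tendsto_of_le_of_le' tendsto_const_nhds h1
    (Eventually.of_forall fun _ => zero_le) ?_
  filter_upwards [hup, self_mem_nhdsWithin] with s hs1 hs3
  have hs3 : 0 < s := hs3
  rw [ENNReal.div_le_iff (by simpa using hs3) ENNReal.ofReal_ne_top]
  calc ∫⁻ ζ in closedBall (x : ℂ) s, ‖ζ - x‖ₑ ∂μ
      ≤ ∫⁻ _ in closedBall (x : ℂ) s, ENNReal.ofReal s ∂μ := by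
        refine setLIntegral_mono measurable_const fun ζ hζ => ?_
        rw [← ofReal_norm, ← dist_eq_norm]
        exact ENNReal.ofReal_le_ofReal hζ
    _ ≤ C * ENNReal.ofReal s * ENNReal.ofReal s := by
        rw [setLIntegral_const, mul_comm]
        exact mul_le_mul_left hs1 _

/-! ### Non-tangential limits -/

section Limits

variable {K : Set ℂ} {c r : ℕ → ℝ} {σ : ℝ} {a z : ℂ} {μ ω : Measure ℂ} {x : ℝ}

/-- The untruncated cone with vertex `x` and aperture one on the side `σ`. -/
def sideCone (σ x : ℝ) : Set ℂ := {z | |z.re - x| < σ * z.im}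

/-- The difference of the Cauchy kernels at a point and at its conjugate. -/
def reflectedCauchy (z ζ : ℂ) : ℂ := (ζ - z)⁻¹ - (ζ - (starRingEnd ℂ) z)⁻¹

theorem reflectedCauchy_ofReal (z : ℂ) (hz : z.im ≠ 0) (t : ℝ) :
    reflectedCauchy z t = ((2 * z.im / ‖(t : ℂ) - z‖ ^ 2 : ℝ) : ℂ) * Complex.I := by
  have h1 : (t : ℂ) - z ≠ 0 := by
    intro h
    have := congrArg Complex.im h
    simp at this
    exact hz this
  have h2 : (t : ℂ) - (starRingEnd ℂ) z = (starRingEnd ℂ) ((t : ℂ) - z) := by simp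
  have h3 : (starRingEnd ℂ) ((t : ℂ) - z) ≠ 0 := (map_ne_zero _).2 h1
  have h4 : (((‖(t : ℂ) - z‖ ^ 2 : ℝ)) : ℂ) = ((t : ℂ) - z) * (starRingEnd ℂ) ((t : ℂ) - z) := by
    rw [Complex.mul_conj, Complex.normSq_eq_norm_sq]
  have h5 : (starRingEnd ℂ) ((t : ℂ) - z) - ((t : ℂ) - z) = ((2 * z.im : ℝ) : ℂ) * Complex.I := by
    apply Complex.ext <;> simp
    ring
  rw [reflectedCauchy, h2, Complex.ofReal_div, h4, inv_sub_inv h1 h3, h5]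
  ring

/-- The wider cone keeps the frontier away from `z`, and the conjugate point is farther still. The
difference of the kernels has numerator `2y`, and `338 = 2 * 13 ^ 2`. -/
theorem norm_reflectedCauchy_le (hσ : σ ^ 2 = 1) {δ : ℝ}
    (hcone : ∀ z : ℂ, z.im ≠ 0 → |z.re - x| ≤ 2 * |z.im| → |z.im| < δ → z ∈ interior K)
    (hz : z ∈ sideCone σ x) (hzδ : 2 * (σ * z.im) < δ) {ζ : ℂ} (hζ : ζ ∈ frontier (sidePart K σ)) :
    ‖reflectedCauchy z ζ‖ ≤ 338 * coneKernel x (σ * z.im) ζ := by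
  set y := σ * z.im with hy
  have hzx : |z.re - x| < y := hz
  have hy0 : 0 < y := (abs_nonneg _).trans_lt hzx
  have hyabs : |z.im| = y := by
    rw [← abs_of_pos hy0, hy, abs_mul, abs_eq_one_of_sq hσ, one_mul]
  -- A point within `y / 4` of `z` has height above `3y / 4` and horizontal offset below `5y / 4`,
  -- so it lies in the cone of aperture two.
  have hfar : y / 4 ≤ ‖ζ - z‖ := by
    by_contra! hlt
    refine notMem_frontier ?_ hζ
    have h1 := (Complex.abs_re_le_norm (ζ - z)).trans_lt hlt
    have h2 := (Complex.abs_im_le_norm (ζ - z)).trans_lt hlt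
    rw [Complex.sub_re] at h1
    rw [Complex.sub_im] at h2
    have h3 : |σ * ζ.im - y| < y / 4 := by
      rwa [hy, ← mul_sub, abs_mul, abs_eq_one_of_sq hσ, one_mul]
    rw [abs_lt] at h3
    have h4 : 0 < σ * ζ.im := by linarith
    have h5 : |ζ.im| = σ * ζ.im := by
      rw [← abs_of_pos h4, abs_mul, abs_eq_one_of_sq hσ, one_mul]
    have h6 := abs_sub_le ζ.re z.re x
    refine ⟨hcone ζ (abs_pos.1 (h5 ▸ h4)) ?_ ?_, h4⟩
    · rw [h5]; linarith
    · rw [h5]; linarith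
  -- `‖ζ - x‖ + y ≤ ‖ζ - z‖ + 3y`, and `3y ≤ 12 ‖ζ - z‖`.
  have hdist : ‖ζ - x‖ + y ≤ 13 * ‖ζ - z‖ := by
    have h1 : ‖z - x‖ ≤ 2 * y := by
      refine (Complex.norm_le_abs_re_add_abs_im _).trans ?_
      simp only [Complex.sub_re, Complex.ofReal_re, Complex.sub_im, Complex.ofReal_im, sub_zero]
      linarith
    have h2 := norm_sub_le_norm_sub_add_norm_sub ζ z x
    linarith
  have hN : 0 < ‖ζ - z‖ := by linarith
  have hconj : ‖ζ - z‖ ≤ ‖ζ - (starRingEnd ℂ) z‖ := by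
    have h1 := closure_sidePart_le hζ.1
    have h2 : 0 ≤ ζ.im * z.im := by
      have : ζ.im * z.im = (σ * ζ.im) * y := by
        rw [hy]; linear_combination (-ζ.im * z.im) * hσ
      rw [this]; positivity
    rw [← sq_le_sq₀ (norm_nonneg _) (norm_nonneg _), ← Complex.normSq_eq_norm_sq,
      ← Complex.normSq_eq_norm_sq, Complex.normSq_apply, Complex.normSq_apply]
    simp only [Complex.sub_re, Complex.sub_im, Complex.conj_re, Complex.conj_im]
    nlinarith
  have hne1 : ζ - z ≠ 0 := norm_pos_iff.1 hN
  have hne2 : ζ - (starRingEnd ℂ) z ≠ 0 := norm_pos_iff.1 (hN.trans_le hconj)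
  have hnum : ‖ζ - (starRingEnd ℂ) z - (ζ - z)‖ = 2 * y := by
    have : ζ - (starRingEnd ℂ) z - (ζ - z) = ((2 * z.im : ℝ) : ℂ) * Complex.I := by
      apply Complex.ext <;> simp
      ring
    rw [this, norm_mul, Complex.norm_I, mul_one, Complex.norm_real, Real.norm_eq_abs, abs_mul,
      hyabs, abs_two]
  rw [reflectedCauchy, inv_sub_inv hne1 hne2, norm_div, norm_mul, hnum, coneKernel]
  have hpos : 0 < ‖ζ - x‖ + y := by positivity
  rw [← mul_div_assoc, div_le_div_iff₀ (mul_pos hN (hN.trans_le hconj)) (by positivity)]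
  have h1 : (‖ζ - x‖ + y) ^ 2 ≤ (13 * ‖ζ - z‖) ^ 2 := by gcongr
  have h2 : ‖ζ - z‖ * ‖ζ - z‖ ≤ ‖ζ - z‖ * ‖ζ - (starRingEnd ℂ) z‖ := by gcongr
  nlinarith

theorem tendsto_sideCone (σ x : ℝ) :
    Tendsto (fun z : ℂ => σ * z.im) (𝓝[sideCone σ x] (x : ℂ)) (𝓝[>] 0) := by
  refine tendsto_nhdsWithin_iff.2 ⟨?_, ?_⟩
  · have h1 : Continuous fun z : ℂ => σ * z.im := continuous_const.mul Complex.continuous_im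
    have h2 := h1.tendsto (x : ℂ)
    rw [Complex.ofReal_im, mul_zero] at h2
    exact h2.mono_left nhdsWithin_le_nhds
  · filter_upwards [self_mem_nhdsWithin] with z hz
    have hzx : |z.re - x| < σ * z.im := hz
    exact (abs_nonneg _).trans_lt hzx

theorem eventually_sideCone (hσ : σ ^ 2 = 1) {δ : ℝ} (hδ : 0 < δ)
    (hcone : ∀ z : ℂ, z.im ≠ 0 → |z.re - x| ≤ 2 * |z.im| → |z.im| < δ → z ∈ interior K) :
    ∀ᶠ z in 𝓝[sideCone σ x] (x : ℂ), z ∈ sidePart K σ ∧ ∀ ζ ∈ frontier (sidePart K σ),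
      ‖reflectedCauchy z ζ‖ ≤ 338 * coneKernel x (σ * z.im) ζ := by
  have h1 := (tendsto_sideCone σ x).eventually
    (eventually_nhdsWithin_of_eventually_nhds (eventually_lt_nhds (half_pos hδ)))
  filter_upwards [h1, self_mem_nhdsWithin] with z hz1 hz2
  have hzx : |z.re - x| < σ * z.im := hz2
  have hy0 : 0 < σ * z.im := (abs_nonneg _).trans_lt hzx
  have hyabs : |z.im| = σ * z.im := by
    rw [← abs_of_pos hy0, abs_mul, abs_eq_one_of_sq hσ, one_mul]
  refine ⟨⟨hcone z (abs_pos.1 (hyabs ▸ hy0)) (by rw [hyabs]; linarith) (by rw [hyabs]; linarith),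
    hy0⟩, fun ζ hζ => norm_reflectedCauchy_le hσ hcone hz2 (by linarith) hζ⟩

/-- The Poisson integral of the part of a measure on the line is bounded below at points of
positive lower density. -/
theorem IsRegularAt.eventually_le [IsFiniteMeasure μ] (h : IsRegularAt μ x) (hσ : σ ^ 2 = 1) :
    ∃ κ > 0, ∀ᶠ z in 𝓝[sideCone σ x] (x : ℂ),
      κ ≤ ‖∫ ζ in realLine, reflectedCauchy z ζ ∂μ‖ := by
  obtain ⟨D, hD, hlow⟩ := h.lower
  -- On the line within `y` of `x` the kernel is at least `2y / (3y) ^ 2`, and the mass there is at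
  -- least `D * y`.
  refine ⟨2 / 9 * D, by positivity, ?_⟩
  filter_upwards [(tendsto_sideCone σ x).eventually hlow, self_mem_nhdsWithin] with z hz1 hz2
  set y := σ * z.im with hy
  have hzx : |z.re - x| < y := hz2
  have hy0 : 0 < y := (abs_nonneg _).trans_lt hzx
  have hyabs : |z.im| = y := by
    rw [← abs_of_pos hy0, hy, abs_mul, abs_eq_one_of_sq hσ, one_mul]
  have him : z.im ≠ 0 := abs_pos.1 (hyabs ▸ hy0)
  have hform : ∀ ζ ∈ realLine, reflectedCauchy z ζ
      = ((2 * z.im / ‖ζ - z‖ ^ 2 : ℝ) : ℂ) * Complex.I := by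
    intro ζ hζ
    have h1 : ((ζ.re : ℝ) : ℂ) = ζ := Complex.ext (by simp) (by simpa [realLine] using hζ.symm)
    rw [← h1]
    exact reflectedCauchy_ofReal z him ζ.re
  rw [setIntegral_congr_fun measurableSet_realLine hform, integral_mul_const, norm_mul,
    Complex.norm_I, mul_one, integral_complex_ofReal, Complex.norm_real, Real.norm_eq_abs]
  have hσz : z.im = σ * y := by rw [hy]; linear_combination (-z.im) * hσ
  have h1 : ∀ ζ : ℂ, 2 * z.im / ‖ζ - z‖ ^ 2 = σ * (2 * y / ‖ζ - z‖ ^ 2) := fun ζ => by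
    rw [hσz]; ring
  simp_rw [h1]
  rw [integral_const_mul, abs_mul, abs_eq_one_of_sq hσ, one_mul]
  have hreal : D * y ≤ μ.real (realLine ∩ closedBall (x : ℂ) y) := by
    rw [measureReal_def, ← ENNReal.ofReal_le_iff_le_toReal (measure_ne_top _ _)]
    exact hz1
  have hSm : MeasurableSet (realLine ∩ closedBall (x : ℂ) y) :=
    measurableSet_realLine.inter measurableSet_closedBall
  have hlow' : ∀ ζ ∈ realLine, y ≤ ‖ζ - z‖ := by
    intro ζ hζ
    have h2 := Complex.abs_im_le_norm (ζ - z)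
    have h3 : ζ.im = 0 := hζ
    rwa [Complex.sub_im, h3, zero_sub, abs_neg, hyabs] at h2
  have hint : IntegrableOn (fun ζ : ℂ => 2 * y / ‖ζ - z‖ ^ 2) realLine μ := by
    refine Measure.integrableOn_of_bounded (M := 2 * y / y ^ 2) (measure_ne_top _ _)
      (Measurable.aestronglyMeasurable (by fun_prop)) ?_
    filter_upwards [ae_restrict_mem measurableSet_realLine] with ζ hζ
    rw [Real.norm_of_nonneg (by positivity)]
    have := hlow' ζ hζ
    gcongr
  calc 2 / 9 * D = 2 * y / (3 * y) ^ 2 * (D * y) := by field_simp; norm_num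
    _ ≤ 2 * y / (3 * y) ^ 2 * μ.real (realLine ∩ closedBall (x : ℂ) y) := by gcongr
    _ = ∫ _ in realLine ∩ closedBall (x : ℂ) y, 2 * y / (3 * y) ^ 2 ∂μ := by
        rw [setIntegral_const, smul_eq_mul, mul_comm]
    _ ≤ ∫ ζ in realLine ∩ closedBall (x : ℂ) y, 2 * y / ‖ζ - z‖ ^ 2 ∂μ := by
        refine setIntegral_mono_on (integrableOn_const (measure_ne_top _ _))
          (hint.mono_set inter_subset_left) hSm fun ζ hζ => ?_
        have h2 := hlow' ζ hζ.1
        have h3 : ‖ζ - z‖ ≤ 3 * y := by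
          have h4 : ‖(x : ℂ) - z‖ ≤ 2 * y := by
            refine (Complex.norm_le_abs_re_add_abs_im _).trans ?_
            simp only [Complex.sub_re, Complex.ofReal_re, Complex.sub_im, Complex.ofReal_im,
              zero_sub, abs_neg]
            rw [abs_sub_comm]
            linarith
          have h5 := norm_sub_le_norm_sub_add_norm_sub ζ x z
          have h6 : ‖ζ - x‖ ≤ y := by simpa [dist_eq_norm] using hζ.2
          linarith
        have h7 : 0 < ‖ζ - z‖ := hy0.trans_le h2
        gcongr
    _ ≤ ∫ ζ in realLine, 2 * y / ‖ζ - z‖ ^ 2 ∂μ :=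
        setIntegral_mono_set hint (Eventually.of_forall fun ζ => by positivity)
          inter_subset_left.eventuallyLE
    _ ≤ _ := le_abs_self _

theorem IsBeads.norm_sub_le (h : IsBeads K c r) (ha : a ∈ sidePart K σ) {ζ : ℂ}
    (hζ : ζ ∈ frontier (sidePart K σ)) : ‖ζ - a‖ ≤ 2 := by
  have h1 := (h.mem_iff.1 (h.closure_sidePart_subset σ hζ.1)).1
  have h2 := (h.mem_iff.1 (sidePart_subset ha)).1
  exact (_root_.norm_sub_le ζ a).trans (by linarith)

theorem IsBeads.integrable_reflectedCauchy (h : IsBeads K c r)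
    (hμ : IsHarmonicMeasure (sidePart K σ) a μ) (hz : z ∈ sidePart K σ) :
    Integrable (reflectedCauchy z) μ := by
  have := hμ.isProbabilityMeasure
  have hK : IsCompact (frontier (sidePart K σ)) :=
    (h.isBounded_sidePart σ).isCompact_closure.of_isClosed_subset isClosed_frontier
      frontier_subset_closure
  rw [← hμ.restrict_frontier]
  exact ContinuousOn.integrableOn_compact hK ((continuousOn_inv_sub (notMem_frontier hz)).sub
    (continuousOn_inv_sub fun hf => conj_notMem_closure hz (frontier_subset_closure hf)))

/-- Write `ζ - a = (x - a) + (ζ - x)`. On the line the reflected kernel is `i` times a real function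
of constant sign, so nothing cancels and the main term is bounded below. The contributions of `ζ -
x` and of the part off the line tend to zero. -/
theorem IsBeads.eventually_le_cauchyWeight (h : IsBeads K c r) (hσ : σ ^ 2 = 1)
    (ha : a ∈ sidePart K σ) (hμ : IsHarmonicMeasure (sidePart K σ) a μ) {δ : ℝ} (hδ : 0 < δ)
    (hcone : ∀ z : ℂ, z.im ≠ 0 → |z.re - x| ≤ 2 * |z.im| → |z.im| < δ → z ∈ interior K)
    (hreg : IsRegularAt μ x) :
    ∃ κ > 0, ∀ᶠ z in 𝓝[sideCone σ x] (x : ℂ), κ ≤ ‖cauchyWeight μ a z‖ := by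
  have hprob := hμ.isProbabilityMeasure
  obtain ⟨κ, hκ, hle⟩ := hreg.eventually_le hσ
  have hev := eventually_sideCone hσ hδ hcone
  have hxa : 0 < ‖(x : ℂ) - a‖ := by
    rw [norm_pos_iff, sub_ne_zero]
    rintro rfl
    exact h.im_ne_zero ha.1 (Complex.ofReal_im x)
  have t1 : Tendsto (fun z => ∫ ζ, (ζ - x) * reflectedCauchy z ζ ∂μ) (𝓝[sideCone σ x] (x : ℂ))
      (𝓝 0) := by
    refine tendsto_integral_of_coneKernel (C := 338) (u := fun ζ => ζ - x) ?_ hreg.tendsto_sub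
      (tendsto_sideCone σ x) (by norm_num) ?_
    · exact hμ.integrable (h.isBounded_sidePart σ) (by fun_prop)
    · filter_upwards [hev] with z hz
      filter_upwards [hμ.ae_mem_frontier] with ζ hζ
      rw [norm_mul, mul_left_comm]
      exact mul_le_mul_of_nonneg_left (hz.2 ζ hζ) (norm_nonneg _)
  have t2 : Tendsto (fun z => ∫ ζ, realLineᶜ.indicator (reflectedCauchy z) ζ ∂μ)
      (𝓝[sideCone σ x] (x : ℂ)) (𝓝 0) := by
    refine tendsto_integral_of_coneKernel (C := 338) (u := realLineᶜ.indicator fun _ => (1 : ℂ)) ?_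
      hreg.tendsto_off_line (tendsto_sideCone σ x) (by norm_num) ?_
    · exact (integrable_const _).indicator measurableSet_realLine.compl
    · filter_upwards [hev] with z hz
      filter_upwards [hμ.ae_mem_frontier] with ζ hζ
      by_cases hζ' : ζ ∈ realLineᶜ
      · rw [indicator_of_mem hζ', indicator_of_mem hζ', norm_one, one_mul]
        exact hz.2 ζ hζ
      · rw [indicator_of_notMem hζ', indicator_of_notMem hζ']
        simp
  have t3 : Tendsto (fun z => ((x : ℂ) - a) * ∫ ζ, realLineᶜ.indicator (reflectedCauchy z) ζ ∂μ)
      (𝓝[sideCone σ x] (x : ℂ)) (𝓝 0) := by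
    simpa using t2.const_mul ((x : ℂ) - a)
  -- Each of the two error terms costs at most a quarter of the main term, leaving half.
  have hη : 0 < ‖(x : ℂ) - a‖ * κ / 4 := by positivity
  have hη' : ‖(0 : ℂ)‖ < ‖(x : ℂ) - a‖ * κ / 4 := by rwa [norm_zero]
  refine ⟨‖(x : ℂ) - a‖ * κ / 2, by positivity, ?_⟩
  filter_upwards [hle, hev, t1.norm.eventually_lt_const hη',
    t3.norm.eventually_lt_const hη'] with z z1 z2 z3 z4
  have hi := h.integrable_reflectedCauchy hμ z2.1
  have hdec : cauchyWeight μ a z = ((x : ℂ) - a) * (∫ ζ in realLine, reflectedCauchy z ζ ∂μ)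
      + ((x : ℂ) - a) * (∫ ζ, realLineᶜ.indicator (reflectedCauchy z) ζ ∂μ)
      + ∫ ζ, (ζ - x) * reflectedCauchy z ζ ∂μ := by
    have hi2 : Integrable (fun ζ => (ζ - x) * reflectedCauchy z ζ) μ := by
      refine hi.bdd_mul (c := 2 + ‖a - x‖) (by fun_prop) ?_
      filter_upwards [hμ.ae_mem_frontier] with ζ hζ
      have h1 := norm_sub_le_norm_sub_add_norm_sub ζ a x
      linarith [h.norm_sub_le ha hζ]
    rw [← mul_add, integral_indicator measurableSet_realLine.compl,
      integral_add_compl measurableSet_realLine hi, ← integral_const_mul,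
      ← integral_add (hi.const_mul _) hi2, h.cauchyWeight_eq hμ z2.1]
    refine integral_congr_ae (Eventually.of_forall fun ζ => ?_)
    simp only [reflectedKernel, reflectedCauchy]
    ring
  have hn : ‖(x : ℂ) - a‖ * κ ≤ ‖((x : ℂ) - a) * ∫ ζ in realLine, reflectedCauchy z ζ ∂μ‖ := by
    rw [norm_mul]
    gcongr
  rw [hdec]
  have h1 := norm_sub_le_norm_add
    (((x : ℂ) - a) * (∫ ζ in realLine, reflectedCauchy z ζ ∂μ)
      + ((x : ℂ) - a) * (∫ ζ, realLineᶜ.indicator (reflectedCauchy z) ζ ∂μ))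
    (∫ ζ, (ζ - x) * reflectedCauchy z ζ ∂μ)
  have h2 := norm_sub_le_norm_add
    (((x : ℂ) - a) * (∫ ζ in realLine, reflectedCauchy z ζ ∂μ))
    (((x : ℂ) - a) * (∫ ζ, realLineᶜ.indicator (reflectedCauchy z) ζ ∂μ))
  linarith

/-- Fatou's theorem for `R²`: almost everywhere on the real points of `K` the extended evaluation
has the boundary function as its non-tangential limit from each side. -/
theorem IsBeads.ae_tendsto_evalMap [IsFiniteMeasure ω] (h : IsBeads K c r) (hσ : σ ^ 2 = 1)
    (hω : ∀ᵐ z ∂ω, z ∈ K) (hle : μ ≤ ω) (ha : a ∈ sidePart K σ)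
    (hμ : IsHarmonicMeasure (sidePart K σ) a μ) {f : Lp ℂ 2 ω} (hf : f ∈ rationalLp K 2 ω) :
    ∀ᵐ x : ℝ, (x : ℂ) ∈ K →
      Tendsto (evalMap K 2 ω f) (𝓝[sideCone σ x] (x : ℂ)) (𝓝 (f x)) := by
  have hprob := hμ.isProbabilityMeasure
  set F : Set ℝ := {x : ℝ | (x : ℂ) ∈ K} with hF
  have hFm : MeasurableSet F := (h.isClosed.preimage Complex.continuous_ofReal).measurableSet
  have hac : volume.restrict F ≪ μ.comap ((↑) : ℝ → ℂ) := by
    refine Measure.AbsolutelyContinuous.mk fun s hs hs0 => ?_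
    rw [measurableEmbedding_ofReal.comap_apply] at hs0
    rw [Measure.restrict_apply hs]
    exact h.volume_eq_zero hσ ha hμ (hs.inter hFm) (fun x hx => hx.2)
      (measure_mono_null (image_mono inter_subset_left) hs0)
  have hfi : Integrable f μ := ((Lp.memLp f).mono_measure hle).integrable one_le_two
  have hleb := hac.ae_le (ae_comap_ofReal
    ((Besicovitch.vitaliFamily μ).ae_tendsto_lintegral_enorm_sub_div hfi.locallyIntegrable))
  have hmain : ∀ᵐ x : ℝ ∂volume.restrict F,
      Tendsto (evalMap K 2 ω f) (𝓝[sideCone σ x] (x : ℂ)) (𝓝 (f x)) := by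
    filter_upwards [ae_isRegularAt hac, hleb, ae_restrict_of_ae h.ae_cone_subset,
      ae_restrict_mem hFm] with x hreg hlebx hconex hxF
    obtain ⟨δ, hδ, hcone⟩ := hconex hxF
    obtain ⟨κ, hκ, hweight⟩ := h.eventually_le_cauchyWeight hσ ha hμ hδ hcone hreg
    have hev := eventually_sideCone hσ hδ hcone
    have hsmall := hreg.tendsto_div (hlebx.comp (Besicovitch.tendsto_filterAt μ (x : ℂ)))
    have hint : Integrable (fun ζ => f ζ - f x) μ := hfi.sub (integrable_const _)
    -- `676 = 2 * 338`, as `|ζ - a| ≤ 2`.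
    have t1 : Tendsto (fun z => ∫ ζ, (f ζ - f x) * reflectedKernel a z ζ ∂μ)
        (𝓝[sideCone σ x] (x : ℂ)) (𝓝 0) := by
      refine tendsto_integral_of_coneKernel (C := 676) hint hsmall (tendsto_sideCone σ x)
        (by norm_num) ?_
      filter_upwards [hev] with z hz
      filter_upwards [hμ.ae_mem_frontier] with ζ hζ
      have h1 : ‖reflectedKernel a z ζ‖ ≤ 2 * (338 * coneKernel x (σ * z.im) ζ) := by
        rw [show reflectedKernel a z ζ = (ζ - a) * reflectedCauchy z ζ from rfl, norm_mul]
        exact mul_le_mul (h.norm_sub_le ha hζ) (hz.2 ζ hζ) (norm_nonneg _) zero_le_two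
      rw [norm_mul]
      refine (mul_le_mul_of_nonneg_left h1 (norm_nonneg _)).trans (le_of_eq ?_)
      ring
    have t2 : Tendsto (fun z => (∫ ζ, (f ζ - f x) * reflectedKernel a z ζ ∂μ) /
        cauchyWeight μ a z) (𝓝[sideCone σ x] (x : ℂ)) (𝓝 0) := by
      have h1 := t1.norm.div_const κ
      rw [norm_zero, zero_div] at h1
      refine squeeze_zero_norm' ?_ h1
      filter_upwards [hweight] with z hz
      rw [norm_div]
      gcongr
    have t3 := t2.add_const (f x)
    rw [zero_add] at t3
    refine t3.congr' ?_
    filter_upwards [hweight, hev] with z hz1 hz2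
    have hne : cauchyWeight μ a z ≠ 0 := norm_pos_iff.1 (hκ.trans_le hz1)
    obtain ⟨C, hC⟩ := h.exists_reflectedKernel_le (a := a) hz2.1
    have hm := (measurable_reflectedKernel a z).aestronglyMeasurable (μ := μ)
    have hi1 := hfi.mul_bdd hm (hμ.ae_mem_frontier.mono hC)
    have hi2 := (integrable_const (μ := μ) (f x)).mul_bdd hm (hμ.ae_mem_frontier.mono hC)
    -- The kernel integrates to the weight, so subtracting `f x` inside the integral subtracts
    -- exactly `f x` from the evaluation.
    rw [h.evalMap_eq hω hle hμ hz2.1 hne hf]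
    simp_rw [sub_mul]
    rw [integral_sub hi1 hi2, integral_const_mul, ← h.cauchyWeight_eq hμ hz2.1]
    field_simp
    ring
  exact (ae_restrict_iff' hFm).1 hmain

end Limits

end MeanRational

end

/-! ### The main theorem: assembling the two sides. -/

theorem mainTheorem4 (K : Set ℂ) (hK : MeanRational.IsStringOfBeads K)
    (hI : Complex.I / 2 ∈ interior K) (ω : Measure ℂ)
    (hω : ω = MeanRational.harmonicMeasure (MeanRational.upperPart K) (Complex.I / 2) +
      MeanRational.harmonicMeasure (MeanRational.lowerPart K) (-(Complex.I / 2))) :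
    interior K ⊆ MeanRational.abpe K 2 ω ∧
    (∀ f ∈ MeanRational.rationalLp K 2 ω, ∀ᵐ x : ℝ, (x : ℂ) ∈ MeanRational.innerBoundary K →
      ∀ α : ℝ, 0 < α → α ≤ 1 →
        MeanRational.HasTopLimit (interior K) (MeanRational.evalMap K 2 ω f) x α (f x) ∧
        MeanRational.HasBottomLimit (interior K) (MeanRational.evalMap K 2 ω f) x α (f x)) ∧
    MeanRational.IsIrreducibleMul K 2 ω := by
  obtain ⟨c, r, hpos, hsub, hdisj, hKeq, hint, hvol⟩ := hK
  have h : MeanRational.IsBeads K c r := ⟨hpos, hsub, hdisj, hKeq, hint⟩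
  have hb : -(Complex.I / 2) ∈ interior K := by
    have h1 : Complex.I / 2 = Complex.I * ((1 / 2 : ℝ) : ℂ) := by push_cast; ring
    rw [h1] at hI ⊢
    exact h.neg_mem_interior hI
  rw [MeanRational.upperPart_eq, h.lowerPart_eq] at hω
  have haU : Complex.I / 2 ∈ MeanRational.sidePart K 1 := ⟨hI, by simp⟩
  have hbL : -(Complex.I / 2) ∈ MeanRational.sidePart K (-1) := ⟨hb, by simp⟩
  have hμU := MeanRational.isHarmonicMeasure_harmonicMeasure (MeanRational.isOpen_sidePart K 1)
    (h.isBounded_sidePart 1) haU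
  have hμL := MeanRational.isHarmonicMeasure_harmonicMeasure (MeanRational.isOpen_sidePart K (-1))
    (h.isBounded_sidePart (-1)) hbL
  set μ := MeanRational.harmonicMeasure (MeanRational.sidePart K 1) (Complex.I / 2)
  set ν := MeanRational.harmonicMeasure (MeanRational.sidePart K (-1)) (-(Complex.I / 2))
  have hprobU := hμU.isProbabilityMeasure
  have hprobL := hμL.isProbabilityMeasure
  have hfin : IsFiniteMeasure ω := hω ▸ inferInstance
  have hleU : μ ≤ ω := hω ▸ Measure.le_add_right le_rfl
  have hleL : ν ≤ ω := hω ▸ Measure.le_add_left le_rfl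
  have hωK : ∀ᵐ z ∂ω, z ∈ K := by
    rw [hω, ae_add_measure_iff]
    exact ⟨hμU.ae_mem_frontier.mono fun z hz => h.closure_sidePart_subset _ hz.1,
      hμL.ae_mem_frontier.mono fun z hz => h.closure_sidePart_subset _ hz.1⟩
  have h1sq : (1 : ℝ) ^ 2 = 1 := by norm_num
  have h2sq : (-1 : ℝ) ^ 2 = 1 := by norm_num
  refine ⟨fun z hz => ?_, fun f hf => ?_, fun A hA ⟨f, hf, hfA⟩ => ?_⟩
  · rcases lt_or_gt_of_ne (h.im_ne_zero hz) with h0 | h0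
    · exact h.sidePart_subset_abpe h2sq hωK hleL hbL hμL ⟨hz, by linarith⟩
    · exact h.sidePart_subset_abpe h1sq hωK hleU haU hμU ⟨hz, by linarith⟩
  · filter_upwards [h.ae_tendsto_evalMap h1sq hωK hleU haU hμU hf,
      h.ae_tendsto_evalMap h2sq hωK hleL hbL hμL hf, h.ae_cone_subset] with x hx1 hx2 hx3 hxi α hα hα1
    have hxK : (x : ℂ) ∈ K := h.isClosed.frontier_subset hxi.1
    obtain ⟨δ, hδ, hcone⟩ := hx3 hxK
    obtain ⟨n, hn⟩ := exists_nat_one_div_lt hδ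
    have hsmall : ∀ z : ℂ, z ∈ ball (x : ℂ) (1 / ((n + 1 : ℕ) : ℝ)) → |z.im| < δ := by
      intro z hz
      have h1 := Complex.abs_im_le_norm (z - x)
      rw [mem_ball, dist_eq_norm] at hz
      push_cast at hz
      simp only [Complex.sub_im, Complex.ofReal_im, sub_zero] at h1
      linarith
    have hUc : ∀ z ∈ MeanRational.upperCone (n + 1) (x : ℂ) α,
        |z.re - x| < z.im ∧ |z.im| < δ := by
      rintro z ⟨hz1, hz2⟩
      have hz1 : |(z - x).re| < α * (z - x).im := hz1
      simp only [Complex.sub_re, Complex.sub_im, Complex.ofReal_re, Complex.ofReal_im,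
        sub_zero] at hz1
      -- `α ≤ 1` puts every such cone inside the cone of aperture one, so the exceptional null set
      -- does not depend on `α`.
      have h0 : 0 < z.im := pos_of_mul_pos_right ((abs_nonneg _).trans_lt hz1) hα.le
      exact ⟨hz1.trans_le (mul_le_of_le_one_left h0.le hα1), hsmall z hz2⟩
    have hLc : ∀ z ∈ MeanRational.lowerCone (n + 1) (x : ℂ) α,
        |z.re - x| < -z.im ∧ |z.im| < δ := by
      rintro z ⟨hz1, hz2⟩
      have hz1 : |(z - x).re| < -α * (z - x).im := hz1
      simp only [Complex.sub_re, Complex.sub_im, Complex.ofReal_re, Complex.ofReal_im,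
        sub_zero] at hz1
      rw [neg_mul_comm] at hz1
      have h0 : 0 < -z.im := pos_of_mul_pos_right ((abs_nonneg _).trans_lt hz1) hα.le
      exact ⟨hz1.trans_le (mul_le_of_le_one_left h0.le hα1), hsmall z hz2⟩
    refine ⟨⟨n + 1, n.succ_pos, fun z hz => ?_, (hx1 hxK).mono_left (nhdsWithin_mono _ ?_)⟩,
      ⟨n + 1, n.succ_pos, fun z hz => ?_, (hx2 hxK).mono_left (nhdsWithin_mono _ ?_)⟩⟩
    · obtain ⟨h1, h2⟩ := hUc z hz
      have h0 : 0 < z.im := (abs_nonneg _).trans_lt h1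
      exact hcone z h0.ne' (by rw [abs_of_pos h0]; linarith) h2
    · intro z hz
      have := (hUc z hz).1
      rwa [← one_mul z.im] at this
    · obtain ⟨h1, h2⟩ := hLc z hz
      have h0 : z.im < 0 := by linarith [(abs_nonneg _).trans_lt h1]
      exact hcone z h0.ne (by rw [abs_of_neg h0]; linarith) h2
    · intro z hz
      have := (hLc z hz).1
      rwa [← neg_one_mul z.im] at this
  · have hU := MeanRational.measure_eq_zero_or_one h.isCompact hωK hleU
      (MeanRational.isOpen_sidePart K 1) (h.isBounded_sidePart 1) (h.closure_sidePart_subset 1)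
      hμU hA hf hfA
    have hL := MeanRational.measure_eq_zero_or_one h.isCompact hωK hleL
      (MeanRational.isOpen_sidePart K (-1)) (h.isBounded_sidePart (-1))
      (h.closure_sidePart_subset (-1)) hμL hA hf hfA
    have hFm : MeasurableSet {x : ℝ | (x : ℂ) ∈ K} :=
      (h.isClosed.preimage Complex.continuous_ofReal).measurableSet
    -- Nullity for either harmonic measure already gives length zero on `K ∩ ℝ`.
    have hnull : ∀ B : Set ℂ, MeasurableSet B → (μ B = 0 ∨ ν B = 0) →
        volume ({x : ℝ | (x : ℂ) ∈ K} ∩ ((↑) : ℝ → ℂ) ⁻¹' B) = 0 := by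
      intro B hB h0
      have hm := hFm.inter (hB.preimage Complex.continuous_ofReal.measurable)
      have hsubset : ((↑) : ℝ → ℂ) '' ({x : ℝ | (x : ℂ) ∈ K} ∩ ((↑) : ℝ → ℂ) ⁻¹' B) ⊆ B := by
        rintro _ ⟨x, hx, rfl⟩
        exact hx.2
      rcases h0 with h0 | h0
      · exact h.volume_eq_zero h1sq haU hμU hm (fun x hx => hx.1) (measure_mono_null hsubset h0)
      · exact h.volume_eq_zero h2sq hbL hμL hm (fun x hx => hx.1) (measure_mono_null hsubset h0)
    -- If one measure lived off `A` and the other off its complement, `K ∩ ℝ` would have length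
    -- zero.
    have hcontra : (μ A = 0 ∨ ν A = 0) → (μ Aᶜ = 0 ∨ ν Aᶜ = 0) → False := by
      intro h1 h2
      have h3 := measure_union_null (hnull A hA h1) (hnull Aᶜ hA.compl h2)
      rw [← inter_union_distrib_left, preimage_compl, union_compl_self, inter_univ] at h3
      exact hvol.ne' h3
    simp only [hω, Measure.add_apply, add_eq_zero]
    tauto
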